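/- **Setting.** Let $\Lambda=\mathcal K\mathcal Q/\langle\rho\rangle$ be a string algebra: $\mathcal Q=(Q_0,Q_1,s,t)$ is a finite quiver, $\rho$ is a finite set of paths generating an admissible ideal, at most two arrows start and at most two arrows end at each vertex, and for each arrow $b$ there is at most one arrow $a$ such that $ab$ is a path not in $\rho$ and at most one arrow $c$ such that $bc$ is a path not in $\rho$ (paths are read from right to left: $ab$ is a path iff $s(a)=t(b)$). Fix maps $\sigma,\tau:Q_1\to\{1,-1\}$ such that for all arrows $a\neq b$: $\sigma(a)=-\sigma(b)$ if $s(a)=s(b)$; $\tau(a)=-\tau(b)$ if $t(a)=t(b)$; and $\sigma(a)=-\tau(b)$ if $s(a)=t(b)$ and $ab\notin\rho$. Syllables are arrows (direct) and formal inverses $a^-$ of arrows (inverse), with $s(a^-)=t(a)$, $t(a^-)=s(a)$, $\sigma(a^-)=\tau(a)$, $\tau(a^-)=\sigma(a)$. A string is either a zero-length string $1_{(v,i)}$ with $v\in Q_0$, $i\in\{1,-1\}$, or a word $\alpha_1\cdots\alpha_n$ ($n\ge1$) in the syllables with $s(\alpha_j)=t(\alpha_{j+1})$ and $\alpha_j\ne\alpha_{j+1}^-$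 for all $j<n$, such that no subword, nor the inverse of a subword, lies in $\rho$. Put $s(\alpha_1\cdots\alpha_n)=s(\alpha_n)$, $\sigma(\alpha_1\cdots\alpha_n)=\sigma(\alpha_n)$, $t(\alpha_1\cdots\alpha_n)=t(\alpha_1)$, $\tau(\alpha_1\cdots\alpha_n)=\tau(\alpha_1)$; $s(1_{(v,i)})=t(1_{(v,i)})=v$, $\tau(1_{(v,i)})=i=-\sigma(1_{(v,i)})$. Inverses are $1_{(v,i)}^-=1_{(v,-i)}$, $(\alpha_1\cdots\alpha_n)^-=\alpha_n^-\cdots\alpha_1^-$. The product $1_{(v,i)}x$ is defined (and equal to $x$) iff $t(x)=v$ and $\tau(x)=i$; $x1_{(v,i)}$ is defined (and equal to $x$) iff $s(x)=v$ and $\sigma(x)=-i$; other products are concatenations of words. For $v\in Q_0$ let $H(v)$ be the set of pairs $(x_1,x_2)$ of strings such that $x_1 1_{(v,1)}$ and $1_{(v,1)}x_2$ are defined and $x_1x_2$ is a string, and let $H_l(v)$ and $H_r(v)$ be its left and right projections. For distinct $x,y\in H_l(v)$ put $x<_l y$ iff, for the longest $w$ with $x=x'w$ and $y=y'w$, either $x'$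 has a direct rightmost syllable or $y'$ has an inverse rightmost syllable. For $x,y\in H_r(v)$ put $x<_r y$ iff $x^-<_l y^-$. The class of *finite description linear orders* is the smallest class of linear orders that contains $\mathbf 0$ and $\mathbf 1$ and is closed under order isomorphisms, binary sums, multiplication by $\omega$, multiplication by $\omega^*$, and finitary shuffles $\Xi(L_0,\dots,L_{n-1})=\sum_{q\in\mathbb Q}L_{\chi(q)}$, where $\chi:\mathbb Q\to\{0,\dots,n-1\}$ has all colour classes dense in $\mathbb Q$. (It contains all finite orders and is closed under products and reversal.) *Automata.* For a finite automaton $M$ over $\{0,1\}$ with partial transition function $\delta$, its *linguage* is its language ordered by the inorder: for distinct words, $x<y$ iff for the longest $w$ with $x=wx'$, $y=wy'$, either $x'$ begins with $0$ or $y'$ begins with $1$. The *word problem* $W_M$ has the states as unknowns and the equations $q=\delta(q,0)\,b_q\,\delta(q,1)$, where undefined transitions are read as the empty word and $b_q=\star$ if $q$ is accepting, $b_q$ empty otherwise. An arrangement is a linear order coloured by letters; a solution of a word problem is a family of arrangements $A_q$ with colour-preserving isomorphisms from $A_q$ to the concatenation of arrangements obtained by substituting $A$ in the right-hand side; morphisms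 of solutions are families of colour-preserving order embeddings compatible with these isomorphisms; a *universal solution* is an initial object. Let $r$ be the length of the longest element of $\rho$ ($r=2$ if $\rho=\emptyset$). A string is *short* if its length is less than $r$; for a string $x$ let $[x]$ be its longest short left factor. Let $M'_\Lambda(v)$ be the automaton whose states are the short strings, all accepting, with start state $1_{(v,1)}$, and with $\delta(x,c)=[\beta x]$ if there is a syllable $\beta$, direct if $c=0$ and inverse if $c=1$, such that $\beta x$ is a string, and $\delta(x,c)$ undefined otherwise. For $x\in H_l(v)$ let $\mathrm{sgn}(x)$ be the binary word obtained by reading the syllables of $x$ from right to left, writing $0$ for direct and $1$ for inverse ones. **Theorem.** For every vertex $v$ of $\mathcal Q$: 1. $(H_l(v),<_l)$ and $(H_r(v),<_r)$ are linear orders, and both are finite description linear orders. 2. $\mathrm{sgn}$ is an order isomorphism from $(H_l(v),<_l)$ onto the linguage of $M'_\Lambda(v)$. 3. The word problem $W_{M'_\Lambda(v)}$ has a universal solution. In any universal solution, the linear order underlying the component at the start state is isomorphic to the linguage of $M'_\Lambda(v)$ (hence to $H_l(v)$), and the linear order underlying every component is a finite description linear order. -/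

import Mathlib

universe u

/-! ## Finite description linear orders

A linear order on a type is given by its strict order relation. -/

/-- A colouring `χ` of the rationals by `n` colours is homogeneous if every colour class is
dense. -/
def IsHomogeneousColoring {n : ℕ} (χ : ℚ → Fin n) : Prop :=
  ∀ k : Fin n, Dense (χ ⁻¹' {k})

/-- The smallest class of linear orders that contains `0` and `1` and is closed under order
isomorphisms, binary sums, multiplication by `ω` and by `ω*`, and finitary shuffles.
The product `L · L'` is the ordered sum of copies of `L` indexed by `L'`, that is, `L' × L`
ordered lexicographically; `Ξ(L_0, …, L_{n-1})` is the ordered sum over `q ∈ ℚ` of `L_{χ(q)}`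
for a homogeneous colouring `χ` of `ℚ` by `n` colours. -/
inductive IsFiniteDescription : {α : Type u} → (α → α → Prop) → Prop
  | zero : IsFiniteDescription (emptyRelation : PEmpty.{u + 1} → PEmpty.{u + 1} → Prop)
  | one : IsFiniteDescription (emptyRelation : PUnit.{u + 1} → PUnit.{u + 1} → Prop)
  | add {α β : Type u} {r : α → α → Prop} {s : β → β → Prop} :
      IsFiniteDescription r → IsFiniteDescription s → IsFiniteDescription (Sum.Lex r s)
  | mulOmega {α : Type u} {r : α → α → Prop} :
      IsFiniteDescription r → IsFiniteDescription (Prod.Lex (fun m n : ℕ => m < n) r)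
  | mulOmegaStar {α : Type u} {r : α → α → Prop} :
      IsFiniteDescription r → IsFiniteDescription (Prod.Lex (fun m n : ℕ => n < m) r)
  | shuffle {n : ℕ} {α : Fin n → Type u} {r : ∀ k, α k → α k → Prop} (χ : ℚ → Fin n) :
      IsHomogeneousColoring χ → (∀ k, IsFiniteDescription (r k)) →
      IsFiniteDescription (Sigma.Lex (fun p q : ℚ => p < q) (fun q => r (χ q)))
  | iso {α β : Type u} {r : α → α → Prop} {s : β → β → Prop} :
      r ≃r s → IsFiniteDescription r → IsFiniteDescription s

/-! ## String algebras -/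

/-- The data `(Q, ρ)` of a string algebra `KQ/⟨ρ⟩`, where the quiver `Q` has vertex set `V` and
arrow set `E`. A path `a₁ a₂ … aₙ` of positive length is the list `[a₁, a₂, …, aₙ]` with
`s(aᵢ) = t(aᵢ₊₁)`. -/
structure StringAlgebra (V E : Type u) where
  /-- the source map -/
  s : E → V
  /-- the target map -/
  t : E → V
  /-- the finite set `ρ` of blocking relations -/
  rel : Finset (List E)
  /-- every blocking relation is a path -/
  rel_isPath : ∀ p ∈ rel, p.IsChain (fun a b => s a = t b)
  /-- Admissibility of `⟨ρ⟩`, first half: `⟨ρ⟩` lies in the square of the arrow ideal. -/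
  two_le_length : ∀ p ∈ rel, 2 ≤ p.length
  /-- Admissibility of `⟨ρ⟩`, second half: `⟨ρ⟩` contains a power of the arrow ideal. (A path lies
  in the ideal generated by the set `ρ` of paths iff it has a subpath in `ρ`.) -/
  exists_rel_infix : ∃ N : ℕ, ∀ p : List E, p.IsChain (fun a b => s a = t b) → N ≤ p.length →
    ∃ q ∈ rel, q <:+: p
  /-- at most two arrows have source `v` -/
  encard_source_le : ∀ v : V, {a : E | s a = v}.encard ≤ 2
  /-- at most two arrows have target `v` -/
  encard_target_le : ∀ v : V, {a : E | t a = v}.encard ≤ 2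
  /-- there is at most one arrow `a` such that `ab` is a path that is not in `ρ` -/
  left_unique : ∀ b a a' : E, s a = t b → s a' = t b → [a, b] ∉ rel → [a', b] ∉ rel → a = a'
  /-- there is at most one arrow `c` such that `bc` is a path that is not in `ρ` -/
  right_unique : ∀ b c c' : E, s b = t c → s b = t c' → [b, c] ∉ rel → [b, c'] ∉ rel → c = c'

namespace StringAlgebra

variable {V E : Type u}

/-- The auxiliary maps `σ, τ : Q₁ → {1, -1}`. -/
structure Signs (Λ : StringAlgebra V E) where
  σ : E → ℤˣ
  τ : E → ℤˣ
  source : ∀ a b : E, a ≠ b → Λ.s a = Λ.s b → σ a = -σ b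
  target : ∀ a b : E, a ≠ b → Λ.t a = Λ.t b → τ a = -τ b
  comp : ∀ a b : E, a ≠ b → Λ.s a = Λ.t b → [a, b] ∉ Λ.rel → σ a = -τ b

/-- Syllables: direct ones are the arrows, inverse ones are formal inverses of arrows. -/
inductive Syllable (E : Type u) : Type u
  | direct : E → Syllable E
  | inverse : E → Syllable E

namespace Syllable

/-- The formal inverse of a syllable. -/
def inv : Syllable E → Syllable E
  | direct a => inverse a
  | inverse a => direct a

/-- `0` (that is, `false`) for direct syllables and `1` (that is, `true`) for inverse ones. -/
def sgn : Syllable E → Bool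
  | direct _ => false
  | inverse _ => true

/-- The source of a syllable. -/
def s (Λ : StringAlgebra V E) : Syllable E → V
  | direct a => Λ.s a
  | inverse a => Λ.t a

/-- The target of a syllable. -/
def t (Λ : StringAlgebra V E) : Syllable E → V
  | direct a => Λ.t a
  | inverse a => Λ.s a

/-- The map `σ` on syllables. -/
def σ {Λ : StringAlgebra V E} (ε : Λ.Signs) : Syllable E → ℤˣ
  | direct a => ε.σ a
  | inverse a => ε.τ a

/-- The map `τ` on syllables. -/
def τ {Λ : StringAlgebra V E} (ε : Λ.Signs) : Syllable E → ℤˣ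
  | direct a => ε.τ a
  | inverse a => ε.σ a

end Syllable

/-- `one v i` is the zero-length walk `1_(v,i)`; `word α l` is the non-empty word `α l`
in the syllables. -/
inductive PreWalk (V E : Type u) : Type u
  | one : V → ℤˣ → PreWalk V E
  | word : Syllable E → List (Syllable E) → PreWalk V E

namespace PreWalk

/-- The list of syllables, from left to right. -/
def toList : PreWalk V E → List (Syllable E)
  | one _ _ => []
  | word α l => α :: l

/-- The length of a walk. -/
def length (x : PreWalk V E) : ℕ := x.toList.length

/-- The source: walks are read from right to left. -/
def s (Λ : StringAlgebra V E) : PreWalk V E → V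
  | one v _ => v
  | word α l => ((α :: l).getLast (List.cons_ne_nil α l)).s Λ

/-- The target. -/
def t (Λ : StringAlgebra V E) : PreWalk V E → V
  | one v _ => v
  | word α _ => α.t Λ

/-- The map `σ` on walks. -/
def σ {Λ : StringAlgebra V E} (ε : Λ.Signs) : PreWalk V E → ℤˣ
  | one _ i => -i
  | word α l => ((α :: l).getLast (List.cons_ne_nil α l)).σ ε

/-- The map `τ` on walks. -/
def τ {Λ : StringAlgebra V E} (ε : Λ.Signs) : PreWalk V E → ℤˣ
  | one _ i => i
  | word α _ => α.τ ε

/-- The inverse walk: `1_(v,i)⁻ = 1_(v,-i)` and `(α₁ … αₙ)⁻ = αₙ⁻ … α₁⁻`. -/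
def inv : PreWalk V E → PreWalk V E
  | one v i => one v (-i)
  | word α l =>
      let m := ((α :: l).map Syllable.inv).reverse
      word (m.head (by simp [m])) m.tail

/-- `α₁ … αₙ` is a walk if `s(αᵢ) = t(αᵢ₊₁)` for `0 < i < n`. -/
def IsWalk (Λ : StringAlgebra V E) (x : PreWalk V E) : Prop :=
  x.toList.IsChain (fun α β => α.s Λ = β.t Λ)

/-- A walk is a string if neither a subword of it nor the inverse of a subword lies in `ρ`, and
no syllable is followed by its inverse. -/
structure IsString (Λ : StringAlgebra V E) (x : PreWalk V E) : Prop where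
  isWalk : x.IsWalk Λ
  no_rel : ∀ p ∈ Λ.rel, ¬ p.map Syllable.direct <:+: x.toList
  no_inv_rel : ∀ p ∈ Λ.rel, ¬ (p.map Syllable.inverse).reverse <:+: x.toList
  reduced : x.toList.IsChain (fun α β => α ≠ β.inv)

/-- `IsConcat ε x y z` says that the concatenation `xy` is defined and equal to `z`. For words,
whether `xy` is a walk is part of the predicate `IsString` on `z`. -/
inductive IsConcat {Λ : StringAlgebra V E} (ε : Λ.Signs) :
    PreWalk V E → PreWalk V E → PreWalk V E → Prop
  | one_left (v : V) (i : ℤˣ) (x : PreWalk V E) :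
      x.t Λ = v → x.τ ε = i → IsConcat ε (one v i) x x
  | one_right (v : V) (i : ℤˣ) (x : PreWalk V E) :
      x.s Λ = v → x.σ ε = -i → IsConcat ε x (one v i) x
  | word (α β : Syllable E) (l m : List (Syllable E)) :
      IsConcat ε (word α l) (word β m) (word α (l ++ β :: m))

/-- The sign sequence: `sgn(1_(v,i)) = []` and `sgn(α y) = sgn(y) sgn(α)`. -/
def sgn (x : PreWalk V E) : List Bool :=
  (x.toList.map Syllable.sgn).reverse

/-- `x <_l y`: for the longest `w` with `x = x' w` and `y = y' w`, either `x'` has a direct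
rightmost syllable or `y'` has an inverse rightmost syllable. -/
def LtL (x y : PreWalk V E) : Prop :=
  ∃ w x' y' : List (Syllable E), x.toList = x' ++ w ∧ y.toList = y' ++ w ∧
    (∀ u, u <:+ x.toList → u <:+ y.toList → u.length ≤ w.length) ∧
    ((∃ a, x'.getLast? = some (.direct a)) ∨ (∃ a, y'.getLast? = some (.inverse a)))

/-- `x <_r y` iff `x⁻ <_l y⁻`. -/
def LtR (x y : PreWalk V E) : Prop := x.inv.LtL y.inv

end PreWalk

open PreWalk

variable {Λ : StringAlgebra V E}

/-- The hammock `H(v)` of pairs `(x₁, x₂)` of strings such that `x₁ 1_(v,1)` and `1_(v,1) x₂` are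
defined and `x₁ x₂` is a string. -/
def hammock (ε : Λ.Signs) (v : V) : Set (PreWalk V E × PreWalk V E) :=
  {x | x.1.IsString Λ ∧ x.2.IsString Λ ∧
    IsConcat ε x.1 (one v 1) x.1 ∧ IsConcat ε (one v 1) x.2 x.2 ∧
    ∃ z, IsConcat ε x.1 x.2 z ∧ z.IsString Λ}

/-- `H_l(v)`, the left projection of `H(v)`. -/
def hammockL (ε : Λ.Signs) (v : V) : Set (PreWalk V E) := Prod.fst '' hammock ε v

/-- `H_r(v)`, the right projection of `H(v)`. -/
def hammockR (ε : Λ.Signs) (v : V) : Set (PreWalk V E) := Prod.snd '' hammock ε v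

/-- The relation `<_l` on `H_l(v)`. -/
def hammockL.lt (ε : Λ.Signs) (v : V) (x y : hammockL ε v) : Prop := x.1.LtL y.1

/-- The relation `<_r` on `H_r(v)`. -/
def hammockR.lt (ε : Λ.Signs) (v : V) (x y : hammockR ε v) : Prop := x.1.LtR y.1

end StringAlgebra

/-! ## Automata and linguages -/

/-- A deterministic finite automaton with a partial transition function. -/
structure PartialDFA (A : Type) where
  State : Type u
  finite : Finite State
  start : State
  accept : Set State
  step : State → A → Option State

namespace PartialDFA

/-- The extension of the transition function to words. -/
def run {A : Type} (M : PartialDFA.{u} A) : M.State → List A → Option M.State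
  | q, [] => some q
  | q, a :: x => (M.step q a).bind (fun q' => M.run q' x)

/-- The language of an automaton. -/
def language {A : Type} (M : PartialDFA.{u} A) : Set (List A) :=
  {x | ∃ q ∈ M.accept, M.run M.start x = some q}

end PartialDFA

/-- The inorder on binary words (with `0 = false` and `1 = true`): for the longest word `w` with
`x = w x'` and `y = w y'`, either `x'` begins with `0` or `y'` begins with `1`. -/
def Inorder (x y : List Bool) : Prop :=
  ∃ w x' y' : List Bool, x = w ++ x' ∧ y = w ++ y' ∧
    (∀ u, u <+: x → u <+: y → u.length ≤ w.length) ∧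
    (x'.head? = some false ∨ y'.head? = some true)

/-- The linguage of an automaton over `{0, 1}`: its language, ordered by the inorder. -/
def PartialDFA.linguage (M : PartialDFA.{u} Bool) (x y : M.language) : Prop :=
  Inorder x.1 y.1

/-! ## Word problems and their universal solutions -/

/-- A word problem over the alphabet `Γ` with unknowns `U`: the system `v = W v`, for `v ∈ U`. -/
abbrev WordProblem (Γ : Type) (U : Type u) := U → List (Γ ⊕ U)

/-- An arrangement over `Γ`: a linear order with a colouring function. -/
structure Arrangement (Γ : Type) where
  carrier : Type u
  lt : carrier → carrier → Prop
  isStrictTotalOrder : IsStrictTotalOrder carrier lt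
  color : carrier → Γ

namespace Arrangement

variable {Γ : Type} {U : Type u}

/-- The one-point arrangement of colour `g`. -/
def letter (g : Γ) : Arrangement.{u} Γ where
  carrier := PUnit
  lt := emptyRelation
  isStrictTotalOrder := { trichotomous := by intro a b _ _; rfl }
  color _ := g

/-- The arrangement substituted for a letter or an unknown. -/
def eval (A : U → Arrangement.{u} Γ) : Γ ⊕ U → Arrangement.{u} Γ
  | .inl g => letter g
  | .inr v => A v

/-- The concatenation of the arrangements substituted for the entries of the word `w`. -/
def subst (A : U → Arrangement.{u} Γ) (w : List (Γ ⊕ U)) : Arrangement.{u} Γ where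
  carrier := Σ i : Fin w.length, (eval A (w.get i)).carrier
  lt := Sigma.Lex (fun i j => i < j) (fun i => (eval A (w.get i)).lt)
  isStrictTotalOrder := by
    have := fun i => (eval A (w.get i)).isStrictTotalOrder
    exact { toTrichotomous := inferInstance, toIsStrictOrder := {} }
  color x := (eval A (w.get x.1)).color x.2

/-- An order isomorphism of arrangements that preserves colours. -/
structure Iso (A B : Arrangement.{u} Γ) where
  toRelIso : A.lt ≃r B.lt
  color_eq : ∀ x, B.color (toRelIso x) = A.color x

/-- A morphism of arrangements: an order embedding that preserves colours. -/
structure Hom (A B : Arrangement.{u} Γ) where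
  toRelEmbedding : A.lt ↪r B.lt
  color_eq : ∀ x, B.color (toRelEmbedding x) = A.color x

/-- The action of a family of morphisms on the arrangements substituted for a letter or an
unknown. -/
def evalMap {A B : U → Arrangement.{u} Γ} (f : ∀ v, Hom (A v) (B v)) :
    ∀ c : Γ ⊕ U, (eval A c).carrier → (eval B c).carrier
  | .inl _ => id
  | .inr v => (f v).toRelEmbedding

/-- The action of a family of morphisms on a substituted word. -/
def substMap {A B : U → Arrangement.{u} Γ} (f : ∀ v, Hom (A v) (B v)) (w : List (Γ ⊕ U))
    (x : (subst A w).carrier) : (subst B w).carrier :=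
  ⟨x.1, evalMap f (w.get x.1) x.2⟩

end Arrangement

namespace WordProblem

variable {Γ : Type} {U : Type u}

/-- A solution in arrangements: a family `A` with isomorphisms `A v ≅ (W v)[A]`. -/
structure Solution (W : WordProblem Γ U) where
  arr : U → Arrangement.{u} Γ
  iso : ∀ v, Arrangement.Iso (arr v) (Arrangement.subst arr (W v))

/-- A family of morphisms between the components of two solutions is a morphism of solutions if
it commutes with the isomorphisms that define the solutions. -/
def IsSolutionHom {W : WordProblem Γ U} (S T : Solution W)
    (f : ∀ v, Arrangement.Hom (S.arr v) (T.arr v)) : Prop :=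
  ∀ v x, (T.iso v).toRelIso ((f v).toRelEmbedding x) =
    Arrangement.substMap f (W v) ((S.iso v).toRelIso x)

/-- The universal solution is the initial object of the category of solutions. -/
def Solution.IsUniversal {W : WordProblem Γ U} (S : Solution W) : Prop :=
  ∀ T : Solution W, ∃! f : ∀ v, Arrangement.Hom (S.arr v) (T.arr v), IsSolutionHom S T f

end WordProblem

open Classical in
/-- The word problem of an automaton, with the states as unknowns: `q = δ(q,0) b δ(q,1)`, where
`b` is the letter `⋆` if `q` is accepting and empty otherwise, and `δ(q,d)` is read as the empty
word where it is undefined. -/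
noncomputable def PartialDFA.wordProblem (M : PartialDFA.{u} Bool) :
    WordProblem Unit M.State := fun q =>
  (M.step q false).toList.map Sum.inr ++ (if q ∈ M.accept then [Sum.inl ()] else []) ++
    (M.step q true).toList.map Sum.inr

/-! ## The automaton of a hammock -/

namespace StringAlgebra

open PreWalk

variable {V E : Type u} {Λ : StringAlgebra V E}

/-- The length of the longest relation in `ρ`, and `2` if `ρ` is empty. -/
def maxRelLength (Λ : StringAlgebra V E) : ℕ := max 2 (Λ.rel.sup List.length)

/-- The short strings: those shorter than the longest relation. -/
def Short (Λ : StringAlgebra V E) : Type u :=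
  {x : PreWalk V E // x.IsString Λ ∧ x.length < Λ.maxRelLength}

/-- The longest left factor of `x` of length less than the longest relation. -/
def PreWalk.truncate (Λ : StringAlgebra V E) : PreWalk V E → PreWalk V E
  | one v i => one v i
  | word α l => word α (l.take (Λ.maxRelLength - 2))

theorem PreWalk.truncate_toList_prefix (Λ : StringAlgebra V E) (x : PreWalk V E) :
    (x.truncate Λ).toList <+: x.toList := by
  cases x with
  | one v i => exact List.prefix_rfl
  | word α l => exact List.prefix_cons_inj α |>.2 (List.take_prefix _ _)

theorem PreWalk.truncate_length_lt (Λ : StringAlgebra V E) (x : PreWalk V E) :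
    (x.truncate Λ).length < Λ.maxRelLength := by
  have h : 2 ≤ Λ.maxRelLength := le_max_left _ _
  cases x with
  | one v i => simp only [truncate, length, toList, List.length_nil]; omega
  | word α l =>
    simp only [truncate, length, toList, List.length_cons, List.length_take]; omega

theorem PreWalk.IsString.truncate {x : PreWalk V E} (h : x.IsString Λ) :
    (x.truncate Λ).IsString Λ where
  isWalk := h.isWalk.prefix (truncate_toList_prefix Λ x)
  no_rel p hp hx := h.no_rel p hp (hx.trans (truncate_toList_prefix Λ x).isInfix)
  no_inv_rel p hp hx := h.no_inv_rel p hp (hx.trans (truncate_toList_prefix Λ x).isInfix)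
  reduced := h.reduced.prefix (truncate_toList_prefix Λ x)

/-- The map `x ↦ [x]` from strings to short strings. -/
def toShort (x : PreWalk V E) (h : x.IsString Λ) : Λ.Short :=
  ⟨x.truncate Λ, h.truncate, x.truncate_length_lt Λ⟩

theorem finite_short [Finite V] [Finite E] (Λ : StringAlgebra V E) : Finite Λ.Short := by
  have e : Finite (Syllable E) := by
    refine Finite.of_injective
      (fun α : Syllable E => match α with | .direct a => (Sum.inl a : E ⊕ E) | .inverse a => .inr a)
      ?_
    rintro (a | a) (b | b) h <;> simp_all
  have hl := (List.finite_length_lt (Syllable E) Λ.maxRelLength).to_subtype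
  let f : Λ.Short → (Option (V × ℤˣ)) × {l : List (Syllable E) // l.length < Λ.maxRelLength} :=
    fun x => (match x.1 with | .one v i => some (v, i) | .word _ _ => none,
      ⟨x.1.toList, x.2.2⟩)
  have : Finite {l : List (Syllable E) // l.length < Λ.maxRelLength} := hl
  refine Finite.of_injective f ?_
  rintro ⟨x, hx⟩ ⟨y, hy⟩ h
  apply Subtype.ext
  cases x <;> cases y <;> simp_all [f, toList]

/-- `z = β x` is a string for some syllable `β` of sign `c`. -/
def IsExtension (ε : Λ.Signs) (x : PreWalk V E) (c : Bool) (z : PreWalk V E) : Prop :=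
  z.IsString Λ ∧ ∃ β : Syllable E, β.sgn = c ∧ IsConcat ε (word β []) x z

open Classical in
/-- The automaton `M'_Λ(v)`: its states are the short strings, all accepting, the start state is
`1_(v,1)`, and `δ(x, c) = [β x]` if there is a (then unique) syllable `β` of sign `c` such that
`β x` is a string. -/
noncomputable def automaton [Finite V] [Finite E] (ε : Λ.Signs) (v : V) :
    PartialDFA.{u} Bool where
  State := Λ.Short
  finite := Λ.finite_short
  start := ⟨one v 1,
    { isWalk := List.isChain_nil
      no_rel := fun p hp h => by
        have h2 := Λ.two_le_length p hp
        have := h.length_le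
        simp only [toList, List.length_map, List.length_nil] at this
        omega
      no_inv_rel := fun p hp h => by
        have h2 := Λ.two_le_length p hp
        have := h.length_le
        simp only [toList, List.length_map, List.length_reverse, List.length_nil] at this
        omega
      reduced := List.isChain_nil },
    lt_of_lt_of_le (by simp [length, toList]) (le_max_left 2 _)⟩
  accept := Set.univ
  step x c :=
    if h : ∃ z, IsExtension ε x.1 c z then some (toShort h.choose h.choose_spec.1) else none

end StringAlgebra

/-!
Reading the syllables of a string from right to left as binary digits turns `<_l` into the inorder
on binary words. Whether a syllable can be prepended to a string depends only on the longest short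
left factor of the string, since no relation is longer than `r`, so the sign sequences of the
strings in a hammock are exactly the words accepted by the automaton.

The words accepted from a state of a finite automaton over `{0, 1}` form a finite description
linear order, by induction on the number of reachable states. Inside a strongly connected component
that contains a cycle, always turning left (or always turning right) as long as this stays in the
component traces an eventually periodic path. The words that never deviate from it before they leave
the component form iterated copies of orders known by induction, arranged in type `ω` or `ω*`. All
other words pass through a state both of whose transitions stay in the component. They are grouped
according to the last such state into convex blocks, of which there are finitely many isomorphism
types; each type occurs between any two blocks, so their sum is a shuffle.

Cutting off the first letter makes the languages of the states into a solution of the word problem.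
It is initial because the length of words decreases along this unfolding: a morphism into another
solution is determined, and can be constructed, by recursion on the length.
-/

/-! ## The inorder on binary words -/

theorem longest_common_prefix_iff {α : Type*} {w x y : List α} :
    (∀ u, u <+: w ++ x → u <+: w ++ y → u.length ≤ w.length) ↔ ∀ a ∈ x.head?, a ∉ y.head? := by
  constructor
  · intro h a hx hy
    have hpre {z : List α} (hz : a ∈ z.head?) : w ++ [a] <+: w ++ z :=
      (List.prefix_append_right_inj w).2 ⟨z.tail, List.cons_head?_tail hz⟩
    simpa using h (w ++ [a]) (hpre hx) (hpre hy)
  · intro h u hx hy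
    by_contra! hlen
    obtain ⟨_ | ⟨a, v⟩, rfl⟩ := List.prefix_of_prefix_length_le (List.prefix_append w x) hx hlen.le
    · simp at hlen
    · obtain ⟨x', rfl⟩ := (List.prefix_append_right_inj w).1 hx
      obtain ⟨y', rfl⟩ := (List.prefix_append_right_inj w).1 hy
      exact h a rfl rfl

theorem exists_longest_common_prefix {α : Type*} (x y : List α) :
    ∃ w x' y', x = w ++ x' ∧ y = w ++ y' ∧ ∀ a ∈ x'.head?, a ∉ y'.head? := by
  induction x generalizing y with
  | nil => exact ⟨[], [], y, by simp⟩
  | cons c x ih =>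
    by_cases hc : c ∈ y.head?
    · obtain ⟨w, x', y', rfl, hy, h⟩ := ih y.tail
      exact ⟨c :: w, x', y', rfl, by rw [List.cons_append, ← hy, List.cons_head?_tail hc], h⟩
    · exact ⟨[], c :: x, y, rfl, rfl, by simpa using hc⟩

/-- The position of a binary word in the inorder, as a rational number in `(-1, 1)`. It embeds the
inorder into `ℚ`, which makes it a strict total order. -/
def inorderVal : List Bool → ℚ
  | [] => 0
  | false :: x => (inorderVal x - 1) / 2
  | true :: x => (inorderVal x + 1) / 2

theorem inorderVal_mem_Ioo (x : List Bool) : inorderVal x ∈ Set.Ioo (-1) 1 := by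
  induction x with
  | nil => simp [inorderVal]
  | cons c x ih =>
    obtain ⟨h₁, h₂⟩ := ih
    cases c <;> simp only [inorderVal] <;> constructor <;> linarith

theorem inorderVal_false_cons_neg (x : List Bool) : inorderVal (false :: x) < 0 := by
  have := (inorderVal_mem_Ioo x).2
  simp only [inorderVal]; linarith

theorem inorderVal_true_cons_pos (x : List Bool) : 0 < inorderVal (true :: x) := by
  have := (inorderVal_mem_Ioo x).1
  simp only [inorderVal]; linarith

theorem inorderVal_append_lt_append (u : List Bool) {x y : List Bool} :
    inorderVal (u ++ x) < inorderVal (u ++ y) ↔ inorderVal x < inorderVal y := by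
  induction u with
  | nil => rfl
  | cons c u ih =>
    rw [← ih]
    cases c <;> simp only [List.cons_append, inorderVal] <;> constructor <;> intro h <;> linarith

theorem inorderVal_lt_iff_of_head {x y : List Bool} (h : ∀ a ∈ x.head?, a ∉ y.head?) :
    inorderVal x < inorderVal y ↔ x.head? = some false ∨ y.head? = some true := by
  rcases x with _ | ⟨_ | _, x⟩ <;> rcases y with _ | ⟨_ | _, y⟩ <;>
    simp only [List.head?_nil, List.head?_cons, Option.mem_def, Option.some.injEq, reduceCtorEq,
      Bool.false_eq_true, Bool.true_eq_false, or_true, or_false, or_self, iff_true,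
      iff_false, not_lt] at h ⊢
  · rfl
  · exact (inorderVal_false_cons_neg y).le
  · exact inorderVal_true_cons_pos y
  · exact inorderVal_false_cons_neg x
  · exact absurd rfl (h false rfl)
  · exact (inorderVal_false_cons_neg x).trans (inorderVal_true_cons_pos y)
  · exact (inorderVal_true_cons_pos x).le
  · exact ((inorderVal_false_cons_neg y).trans (inorderVal_true_cons_pos x)).le
  · exact absurd rfl (h true rfl)

theorem inorder_iff_inorderVal_lt {x y : List Bool} :
    Inorder x y ↔ inorderVal x < inorderVal y := by
  constructor
  · rintro ⟨w, x', y', rfl, rfl, hw, h⟩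
    exact (inorderVal_append_lt_append w).2
      ((inorderVal_lt_iff_of_head (longest_common_prefix_iff.1 hw)).2 h)
  · intro h
    obtain ⟨w, x', y', rfl, rfl, hw⟩ := exists_longest_common_prefix x y
    exact ⟨w, x', y', rfl, rfl, longest_common_prefix_iff.2 hw,
      (inorderVal_lt_iff_of_head hw).1 ((inorderVal_append_lt_append w).1 h)⟩

theorem inorderVal_injective : Function.Injective inorderVal := by
  intro x y hxy
  obtain ⟨w, x', y', rfl, rfl, hw⟩ := exists_longest_common_prefix x y
  have hlt := mt (inorderVal_append_lt_append w).2 hxy.not_lt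
  have hgt := mt (inorderVal_append_lt_append w).2 hxy.not_gt
  rw [inorderVal_lt_iff_of_head hw] at hlt
  rw [inorderVal_lt_iff_of_head fun a hy hx => hw a hx hy] at hgt
  rcases x' with _ | ⟨_ | _, x'⟩ <;> rcases y' with _ | ⟨_ | _, y'⟩ <;> simp_all

instance : IsStrictTotalOrder (List Bool) Inorder where
  trichotomous _ _ hxy hyx :=
    inorderVal_injective (le_antisymm (not_lt.1 (mt inorder_iff_inorderVal_lt.2 hyx))
      (not_lt.1 (mt inorder_iff_inorderVal_lt.2 hxy)))
  irrefl _ h := lt_irrefl _ (inorder_iff_inorderVal_lt.1 h)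
  trans _ _ _ hxy hyz :=
    inorder_iff_inorderVal_lt.2
      ((inorder_iff_inorderVal_lt.1 hxy).trans (inorder_iff_inorderVal_lt.1 hyz))

namespace Inorder

theorem append_append_iff (u : List Bool) {x y : List Bool} :
    Inorder (u ++ x) (u ++ y) ↔ Inorder x y := by
  simp only [inorder_iff_inorderVal_lt, inorderVal_append_lt_append]

theorem cons_cons_iff {c : Bool} {x y : List Bool} : Inorder (c :: x) (c :: y) ↔ Inorder x y :=
  append_append_iff [c]

theorem iff_of_head {x y : List Bool} (h : ∀ a ∈ x.head?, a ∉ y.head?) :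
    Inorder x y ↔ x.head? = some false ∨ y.head? = some true :=
  inorder_iff_inorderVal_lt.trans (inorderVal_lt_iff_of_head h)

theorem append_right {x y : List Bool} (h : Inorder x y) (hyx : ¬ y <+: x) (z : List Bool) :
    Inorder x (y ++ z) := by
  obtain ⟨w, x', y', rfl, rfl, hw⟩ := exists_longest_common_prefix x y
  rw [List.append_assoc, append_append_iff] at *
  have hy' : (y' ++ z).head? = y'.head? :=
    List.head?_append_of_ne_nil _ (by rintro rfl; simp at hyx)
  rw [iff_of_head hw] at h
  rwa [iff_of_head (hy' ▸ hw), hy']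

theorem append_left {x y : List Bool} (h : Inorder x y) (hxy : ¬ x <+: y) (z : List Bool) :
    Inorder (x ++ z) y := by
  obtain ⟨w, x', y', rfl, rfl, hw⟩ := exists_longest_common_prefix x y
  rw [List.append_assoc, append_append_iff] at *
  have hx' : (x' ++ z).head? = x'.head? :=
    List.head?_append_of_ne_nil _ (by rintro rfl; simp at hxy)
  rw [iff_of_head hw] at h
  rwa [iff_of_head (hx' ▸ hw), hx']

theorem append_lt_or_lt_append {x y : List Bool} (h : Inorder x y) :
    (∀ z, Inorder (x ++ z) y) ∨ ∀ z, Inorder x (y ++ z) := by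
  by_cases hxy : x <+: y
  · refine Or.inr (h.append_right fun hyx => ?_)
    exact irrefl_of Inorder _ (hxy.eq_of_length_le hyx.length_le ▸ h)
  · exact Or.inl (h.append_left hxy)

end Inorder

/-- The inorder on a set of words, lifted to the universe of the class of finite description linear
orders. -/
def InorderOn (s : Set (List Bool)) (x y : ULift.{u} s) : Prop := Inorder x.down.1 y.down.1

instance (s : Set (List Bool)) : IsStrictTotalOrder (ULift.{u} s) (InorderOn s) where
  trichotomous _ _ hxy hyx :=
    ULift.ext _ _ (Subtype.ext (Std.Trichotomous.trichotomous _ _ hxy hyx))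
  irrefl _ := irrefl_of Inorder _
  trans _ _ _ := trans_of Inorder

/-- The inorder if `e = true` and its reverse if `e = false`. It serves to state mirror images of a
fact about binary words at once. -/
def SideLT (e : Bool) (x y : List Bool) : Prop := if e then Inorder x y else Inorder y x

theorem sideLT_not {e : Bool} {x y : List Bool} : SideLT (!e) x y ↔ SideLT e y x := by
  cases e <;> rfl

theorem sideLT_append {e : Bool} (u : List Bool) {x y : List Bool} :
    SideLT e (u ++ x) (u ++ y) ↔ SideLT e x y := by
  cases e <;> exact Inorder.append_append_iff u

theorem sideLT_cons {e c : Bool} {x y : List Bool} : SideLT e (c :: x) (c :: y) ↔ SideLT e x y :=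
  sideLT_append [c]

theorem sideLT_cons_of_head {e : Bool} {x : List Bool} (h : e ∉ x.head?) (z : List Bool) :
    SideLT e x (e :: z) := by
  cases e
  · exact (Inorder.iff_of_head fun a ha => by simp_all).2 (Or.inl rfl)
  · exact (Inorder.iff_of_head fun a ha => by simp_all).2 (Or.inr rfl)

theorem sideLT_not_cons_of_head {e : Bool} {x : List Bool} (h : (!e) ∉ x.head?) (z : List Bool) :
    SideLT e ((!e) :: z) x :=
  sideLT_not.1 (sideLT_cons_of_head h z)

theorem sideLT_append_cons (x : List Bool) (e : Bool) (z : List Bool) :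
    SideLT e x (x ++ e :: z) := by
  simpa using (sideLT_append x).2 (sideLT_cons_of_head (x := []) (by simp) z)

theorem sideLT_iterate_append {e : Bool} (u : List Bool) (n : ℕ) {x y : List Bool} :
    SideLT e ((u ++ ·)^[n] x) ((u ++ ·)^[n] y) ↔ SideLT e x y := by
  induction n with
  | zero => rfl
  | succ n ih => rw [Function.iterate_succ_apply', Function.iterate_succ_apply', sideLT_append, ih]

theorem sideLT_iterate_append_of_lt {e : Bool} {u x : List Bool} (h : ∀ z, SideLT e (u ++ z) x)
    (y : List Bool) {m n : ℕ} (hmn : m < n) : SideLT e ((u ++ ·)^[n] y) ((u ++ ·)^[m] x) := by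
  obtain ⟨k, rfl⟩ := Nat.exists_eq_add_of_lt hmn
  rw [add_assoc, Function.iterate_add_apply, sideLT_iterate_append, Function.iterate_succ_apply']
  exact h _

/-! ## Sets of words of finite description -/

/-- A set of words, ordered by the inorder, is a finite description linear order. -/
def FiniteDescriptionOn (s : Set (List Bool)) : Prop :=
  IsFiniteDescription (InorderOn.{u} s)

namespace FiniteDescriptionOn

theorem of_map {β : Type u} {r : β → β → Prop} [Std.Trichotomous r] (hr : IsFiniteDescription r)
    (f : β → List Bool) (hf : ∀ a b, r a b → Inorder (f a) (f b)) {s : Set (List Bool)}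
    (hs : Set.range f = s) : FiniteDescriptionOn.{u} s := by
  subst hs
  let g : r ↪r InorderOn (Set.range f) := RelEmbedding.ofMonotone (fun b => ⟨f b, b, rfl⟩) hf
  exact hr.iso (RelIso.ofSurjective g fun ⟨⟨_, b, hb⟩⟩ => ⟨b, ULift.ext _ _ (Subtype.ext hb)⟩)

theorem empty : FiniteDescriptionOn.{u} ∅ :=
  have : Std.Trichotomous (emptyRelation : PEmpty.{u + 1} → PEmpty.{u + 1} → Prop) :=
    ⟨fun a => a.elim⟩
  of_map .zero PEmpty.elim (fun a => a.elim) (Set.range_eq_empty _)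

theorem singleton (x : List Bool) : FiniteDescriptionOn.{u} {x} :=
  have : Std.Trichotomous (emptyRelation : PUnit.{u + 1} → PUnit.{u + 1} → Prop) :=
    ⟨fun _ _ _ _ => rfl⟩
  of_map .one (fun _ => x) (fun _ _ h => h.elim) Set.range_const

theorem sep_singleton (x : List Bool) (p : Prop) : FiniteDescriptionOn.{u} {w | w = x ∧ p} := by
  by_cases hp : p
  · simpa [hp] using singleton x
  · simpa [hp] using empty

theorem union {s t : Set (List Bool)} (hs : FiniteDescriptionOn.{u} s)
    (ht : FiniteDescriptionOn.{u} t) (h : ∀ x ∈ s, ∀ y ∈ t, Inorder x y) :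
    FiniteDescriptionOn.{u} (s ∪ t) := by
  refine of_map (hs.add ht) (Sum.elim (fun x => x.down.1) fun x => x.down.1) ?_ (by
    ext; simp)
  rintro _ _ (hlt | hlt | _)
  · exact hlt
  · exact hlt
  · exact h _ (Subtype.mem _) _ (Subtype.mem _)

theorem union_side (e : Bool) {s t : Set (List Bool)} (hs : FiniteDescriptionOn.{u} s)
    (ht : FiniteDescriptionOn.{u} t) (h : ∀ x ∈ s, ∀ y ∈ t, SideLT e x y) :
    FiniteDescriptionOn.{u} (s ∪ t) := by
  cases e
  · rw [Set.union_comm]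
    exact ht.union hs fun x hx y hy => h y hy x hx
  · exact hs.union ht h

theorem image_append {s : Set (List Bool)} (hs : FiniteDescriptionOn.{u} s) (u : List Bool) :
    FiniteDescriptionOn.{u} ((u ++ ·) '' s) :=
  of_map hs (fun x => u ++ x.down.1) (fun _ _ => (Inorder.append_append_iff u).2) (by
    ext; simp)

theorem image_cons {s : Set (List Bool)} (hs : FiniteDescriptionOn.{u} s) (c : Bool) :
    FiniteDescriptionOn.{u} ((c :: ·) '' s) :=
  hs.image_append [c]

theorem mem_iff_exists_iterate_append {s t : Set (List Bool)} {u : List Bool} (hu : u ≠ [])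
    (ht : t = s ∪ (u ++ ·) '' t) {x : List Bool} :
    x ∈ t ↔ ∃ k : ℕ, ∃ y ∈ s, (u ++ ·)^[k] y = x := by
  constructor
  · intro hx
    induction hn : x.length using Nat.strong_induction_on generalizing x with
    | _ n ih =>
      rw [ht] at hx
      obtain hx | ⟨x', hx', rfl⟩ := hx
      · exact ⟨0, x, hx, rfl⟩
      · have hlt : x'.length < n := by
          simpa [← hn] using List.length_pos_iff.2 hu
        obtain ⟨k, y, hy, rfl⟩ := ih _ hlt hx' rfl
        exact ⟨k + 1, y, hy, Function.iterate_succ_apply' _ _ _⟩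
  · rintro ⟨k, y, hy, rfl⟩
    induction k with
    | zero => exact ht ▸ Or.inl hy
    | succ k ih =>
      rw [ht]
      exact Or.inr ⟨_, ih, (Function.iterate_succ_apply' _ _ _).symm⟩

theorem of_eq_union_image_append (e : Bool) {s t : Set (List Bool)} {u : List Bool} (hu : u ≠ [])
    (hs : FiniteDescriptionOn.{u} s) (ht : t = s ∪ (u ++ ·) '' t)
    (h : ∀ x ∈ s, ∀ z, SideLT e (u ++ z) x) : FiniteDescriptionOn.{u} t := by
  let f (b : ℕ × ULift s) : List Bool := (u ++ ·)^[b.1] b.2.down.1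
  have hf : Set.range f = t := by
    ext x
    simp [f, mem_iff_exists_iterate_append hu ht]
  cases e
  · refine of_map hs.mulOmega f ?_ hf
    rintro _ _ (⟨_, _, hlt⟩ | ⟨_, hlt⟩)
    · exact sideLT_iterate_append_of_lt (h _ (Subtype.mem _)) _ hlt
    · exact (sideLT_iterate_append (e := true) _ _).2 hlt
  · have : Std.Trichotomous fun m n : ℕ => n < m := ⟨fun _ _ h h' => by omega⟩
    refine of_map hs.mulOmegaStar f ?_ hf
    rintro _ _ (⟨_, _, hlt⟩ | ⟨_, hlt⟩)
    · exact sideLT_iterate_append_of_lt (h _ (Subtype.mem _)) _ hlt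
    · exact (sideLT_iterate_append (e := true) _ _).2 hlt

section Periodic

variable {ι : Type*} {X t : ι → Set (List Bool)} {f : ι → ι} {d : ι → Bool} {e : Bool}

theorem exists_eq_union_image_append_iterate (hX : ∀ i, X i = t i ∪ (d i :: ·) '' X (f i))
    (ht : ∀ i, FiniteDescriptionOn.{u} (t i))
    (h : ∀ i, ∀ x ∈ t i, ∀ z, SideLT e (d i :: z) x) (n : ℕ) (i : ι) :
    ∃ (u : List Bool) (s : Set (List Bool)), u.length = n ∧ FiniteDescriptionOn.{u} s ∧
      X i = s ∪ (u ++ ·) '' X (f^[n] i) ∧ ∀ x ∈ s, ∀ z, SideLT e (u ++ z) x := by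
  induction n generalizing i with
  | zero => exact ⟨[], ∅, rfl, empty, by simp, by simp⟩
  | succ n ih =>
    obtain ⟨u, s, rfl, hs, hXs, hlt⟩ := ih (f i)
    refine ⟨d i :: u, (d i :: ·) '' s ∪ t i, rfl, (hs.image_cons _).union_side e (ht i) ?_, ?_, ?_⟩
    · rintro _ ⟨x, -, rfl⟩ y hy
      exact h i y hy x
    · rw [hX i, hXs, Set.image_union, Set.image_image, Set.union_comm _ (t i), Set.union_assoc]
      rfl
    · rintro _ (⟨x, hx, rfl⟩ | hx) z
      · exact sideLT_cons.2 (hlt x hx z)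
      · exact h i _ hx _

theorem of_eq_union_image_cons [Finite ι] (hX : ∀ i, X i = t i ∪ (d i :: ·) '' X (f i))
    (ht : ∀ i, FiniteDescriptionOn.{u} (t i))
    (h : ∀ i, ∀ x ∈ t i, ∀ z, SideLT e (d i :: z) x) (i : ι) : FiniteDescriptionOn.{u} (X i) := by
  obtain ⟨m, n, hmn, hper⟩ : ∃ m n, m < n ∧ f^[m] i = f^[n] i := by
    obtain ⟨m, n, hne, hper⟩ := Finite.exists_ne_map_eq_of_infinite fun n => f^[n] i
    exact hne.lt_or_gt.elim (fun hlt => ⟨m, n, hlt, hper⟩) fun hlt => ⟨n, m, hlt, hper.symm⟩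
  have hcycle : FiniteDescriptionOn.{u} (X (f^[m] i)) := by
    obtain ⟨u, s, hu, hs, hXs, hlt⟩ :=
      exists_eq_union_image_append_iterate hX ht h (n - m) (f^[m] i)
    rw [← Function.iterate_add_apply, Nat.sub_add_cancel hmn.le, ← hper] at hXs
    exact of_eq_union_image_append e (List.length_pos_iff.1 (by omega)) hs hXs hlt
  obtain ⟨u, s, -, hs, hXs, hlt⟩ := exists_eq_union_image_append_iterate hX ht h m i
  rw [hXs, Set.union_comm]
  refine (hcycle.image_append u).union_side e hs ?_
  rintro _ ⟨x, -, rfl⟩ y hy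
  exact hlt y hy x

end Periodic

end FiniteDescriptionOn

theorem IsFiniteDescription.shuffle_of_finite {B : Type*} [Finite B] {α : B → Type u}
    {r : ∀ k, α k → α k → Prop} (χ : ℚ → B) (hχ : ∀ k, Dense (χ ⁻¹' {k}))
    (hr : ∀ k, IsFiniteDescription (r k)) :
    IsFiniteDescription (Sigma.Lex (fun p q : ℚ => p < q) fun q => r (χ q)) := by
  obtain ⟨n, ⟨e⟩⟩ := Finite.exists_equiv_fin B
  have hcolor : IsHomogeneousColoring (e ∘ χ) := fun k => by
    simpa [Set.preimage, Equiv.eq_symm_apply] using hχ (e.symm k)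
  have hrecolor : ∀ χ' : ℚ → B, χ' = χ →
      IsFiniteDescription (Sigma.Lex (fun p q : ℚ => p < q) fun q => r (χ' q)) →
      IsFiniteDescription (Sigma.Lex (fun p q : ℚ => p < q) fun q => r (χ q)) := by
    rintro _ rfl h
    exact h
  exact hrecolor _ (funext fun q => e.symm_apply_apply (χ q))
    (.shuffle _ hcolor fun k => hr (e.symm k))

theorem exists_orderIso_rat_dense_preimage {N B : Type*} [LinearOrder N] [Countable N] [Nonempty N]
    (c : N → B) (hlt : ∀ x k, ∃ y < x, c y = k) (hgt : ∀ x k, ∃ y > x, c y = k)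
    (hbtw : ∀ x y, x < y → ∀ k, ∃ z, x < z ∧ z < y ∧ c z = k) :
    ∃ φ : ℚ ≃o N, ∀ k, Dense ((c ∘ φ) ⁻¹' {k}) := by
  have : NoMinOrder N := ⟨fun x => (hlt x (c x)).imp fun _ h => h.1⟩
  have : NoMaxOrder N := ⟨fun x => (hgt x (c x)).imp fun _ h => h.1⟩
  have : DenselyOrdered N := ⟨fun x y h => (hbtw x y h (c x)).imp fun _ h => ⟨h.1, h.2.1⟩⟩
  obtain ⟨φ⟩ := Order.iso_of_countable_dense ℚ N
  refine ⟨φ, fun k => dense_of_exists_between fun p q hpq => ?_⟩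
  obtain ⟨z, hpz, hzq, hz⟩ := hbtw _ _ (φ.strictMono hpq) k
  exact ⟨φ.symm z, by simpa using hz, φ.lt_symm_apply.2 hpz, φ.symm_apply_lt.2 hzq⟩

/-- Nodes of the binary tree are coloured so that above either successor of a node there are nodes
of every colour; attaching to each node a copy of the set of its colour gives a shuffle. -/
theorem FiniteDescriptionOn.shuffle {B : Type*} [Finite B] {b : B → Set (List Bool)}
    (hb : ∀ k, FiniteDescriptionOn.{u} (b k)) {N : Type*} [Nonempty N] {node : N → List Bool}
    (hnode : Function.Injective node) (c : N → B)
    (hc : ∀ x e k, ∃ z y, node y = node x ++ e :: z ∧ c y = k)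
    (hmono : ∀ x y, Inorder (node x) (node y) → ∀ v ∈ b (c x), ∀ w ∈ b (c y),
      Inorder (node x ++ v) (node y ++ w)) :
    FiniteDescriptionOn.{u} {w | ∃ x, ∃ v ∈ b (c x), w = node x ++ v} := by
  let : LinearOrder N := .lift' (inorderVal ∘ node) (inorderVal_injective.comp hnode)
  have hlt_iff {x y : N} : x < y ↔ Inorder (node x) (node y) := inorder_iff_inorderVal_lt.symm
  have := hnode.countable
  obtain ⟨φ, hφ⟩ := exists_orderIso_rat_dense_preimage c
    (fun x k => by
      obtain ⟨z, y, hy, hk⟩ := hc x false k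
      exact ⟨y, hlt_iff.2 (hy ▸ sideLT_append_cons _ false z), hk⟩)
    (fun x k => by
      obtain ⟨z, y, hy, hk⟩ := hc x true k
      exact ⟨y, hlt_iff.2 (hy ▸ sideLT_append_cons _ true z), hk⟩)
    (fun x y hxy k => by
      obtain hbelow | habove := (hlt_iff.1 hxy).append_lt_or_lt_append
      · obtain ⟨z, u, hu, hk⟩ := hc x true k
        exact ⟨u, hlt_iff.2 (hu ▸ sideLT_append_cons _ true z), hlt_iff.2 (hu ▸ hbelow _), hk⟩
      · obtain ⟨z, u, hu, hk⟩ := hc y false k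
        exact ⟨u, hlt_iff.2 (hu ▸ habove _), hlt_iff.2 (hu ▸ sideLT_append_cons _ false z), hk⟩)
  refine of_map (.shuffle_of_finite (c ∘ φ) hφ hb) (fun x => node (φ x.1) ++ x.2.down.1) ?_ ?_
  · rintro _ _ (⟨v, w, hlt⟩ | ⟨v, w, hlt⟩)
    · exact hmono _ _ (hlt_iff.1 (φ.strictMono hlt)) _ v.down.2 _ w.down.2
    · exact (Inorder.append_append_iff _).2 hlt
  · ext w
    constructor
    · rintro ⟨⟨q, v⟩, rfl⟩
      exact ⟨φ q, v.down.1, v.down.2, rfl⟩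
    · rintro ⟨x, v, hv, rfl⟩
      obtain ⟨q, rfl⟩ := φ.surjective x
      exact ⟨⟨q, ⟨v, hv⟩⟩, rfl⟩

/-! ## Linguages are finite description linear orders -/

namespace PartialDFA

section Run

variable {A : Type} {M : PartialDFA.{u} A} {p q r : M.State} {a : A} {x y : List A}

instance : Finite M.State := M.finite

theorem run_append : M.run q (x ++ y) = (M.run q x).bind fun p => M.run p y := by
  induction x generalizing q with
  | nil => rfl
  | cons a x ih =>
    simp only [List.cons_append, run]
    cases M.step q a with
    | none => rfl
    | some p => exact ih

theorem run_concat_eq_some_iff :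
    M.run q (x ++ [a]) = some p ↔ ∃ r, M.run q x = some r ∧ M.step r a = some p := by
  simp only [run_append, run, Option.bind_eq_some_iff, Option.some.injEq, exists_eq_right]

theorem run_cons_of_step (h : M.step q a = some p) (x : List A) :
    M.run q (a :: x) = M.run p x := by
  simp only [run, h, Option.bind_some]

/-- The state `q` is reachable from the state `p`. -/
def Reaches (M : PartialDFA.{u} A) (p q : M.State) : Prop := ∃ x, M.run p x = some q

theorem Reaches.refl (p : M.State) : M.Reaches p p := ⟨[], rfl⟩

theorem Reaches.trans (hpq : M.Reaches p q) (hqr : M.Reaches q r) : M.Reaches p r := by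
  obtain ⟨x, hx⟩ := hpq
  obtain ⟨y, hy⟩ := hqr
  exact ⟨x ++ y, by rw [run_append, hx, Option.bind_some, hy]⟩

theorem Reaches.of_step (h : M.step p a = some q) : M.Reaches p q :=
  ⟨[a], run_cons_of_step h []⟩

/-- The words accepted from the state `q`. -/
def languageFrom (M : PartialDFA.{u} A) (q : M.State) : Set (List A) :=
  {x | ∃ p ∈ M.accept, M.run q x = some p}

theorem nil_mem_languageFrom : [] ∈ M.languageFrom q ↔ q ∈ M.accept := by
  simp [languageFrom, run]

theorem cons_mem_languageFrom :
    a :: x ∈ M.languageFrom q ↔ ∃ p, M.step q a = some p ∧ x ∈ M.languageFrom p := by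
  simp only [languageFrom, run, Set.mem_ofPred_eq, Option.bind_eq_some_iff]
  tauto

theorem cons_mem_languageFrom_of_step (h : M.step q a = some p) :
    a :: x ∈ M.languageFrom q ↔ x ∈ M.languageFrom p := by
  simp [cons_mem_languageFrom, h]

theorem append_mem_languageFrom (h : M.run q x = some p) :
    x ++ y ∈ M.languageFrom q ↔ y ∈ M.languageFrom p := by
  simp [languageFrom, run_append, h]

end Run

variable {M : PartialDFA.{u} Bool}

theorem finiteDescriptionOn_sep_head {q : M.State} {c : Bool}
    (h : ∀ p, M.step q c = some p → FiniteDescriptionOn.{u} (M.languageFrom p)) :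
    FiniteDescriptionOn.{u} {w ∈ M.languageFrom q | w.head? = some c} := by
  cases hq : M.step q c with
  | none =>
    convert FiniteDescriptionOn.empty
    ext (_ | ⟨d, w⟩)
    · simp
    · simp only [cons_mem_languageFrom, Set.mem_ofPred_eq, List.head?_cons, Option.some.injEq,
        Set.mem_empty_iff_false, iff_false]
      rintro ⟨⟨p, hp, -⟩, rfl⟩
      simp [hq] at hp
  | some p =>
    convert (h p hq).image_cons c
    ext (_ | ⟨d, w⟩)
    · simp
    · simp only [Set.mem_ofPred_eq, List.head?_cons, Option.some.injEq, Set.mem_image,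
        List.cons.injEq]
      constructor
      · rintro ⟨hw, rfl⟩
        exact ⟨w, (cons_mem_languageFrom_of_step hq).1 hw, rfl, rfl⟩
      · rintro ⟨_, hw, rfl, rfl⟩
        exact ⟨(cons_mem_languageFrom_of_step hq).2 hw, rfl⟩

theorem finiteDescriptionOn_of_step {q : M.State}
    (h : ∀ c p, M.step q c = some p → FiniteDescriptionOn.{u} (M.languageFrom p)) :
    FiniteDescriptionOn.{u} (M.languageFrom q) := by
  have hsplit : M.languageFrom q = ({w ∈ M.languageFrom q | w.head? = some false} ∪
      {w | w = [] ∧ q ∈ M.accept}) ∪ {w ∈ M.languageFrom q | w.head? = some true} := by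
    ext (_ | ⟨_ | _, w⟩) <;> simp [nil_mem_languageFrom]
  rw [hsplit]
  refine ((finiteDescriptionOn_sep_head (h false)).union (.sep_singleton _ _) ?_).union
    (finiteDescriptionOn_sep_head (h true)) ?_
  · rintro x ⟨-, hx⟩ _ ⟨rfl, -⟩
    exact (Inorder.iff_of_head (by simp)).2 (Or.inl hx)
  · rintro x hx y ⟨-, hy⟩
    refine (Inorder.iff_of_head fun a ha => ?_).2 (Or.inr hy)
    rintro hy'
    obtain ⟨-, hx⟩ | ⟨rfl, -⟩ := hx <;> simp_all

/-- From `p`, reading the letter `c` leads to a state of `C`. -/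
def Stays (M : PartialDFA.{u} Bool) (C : Set M.State) (c : Bool) (p : M.State) : Prop :=
  ∃ p' ∈ C, M.step p c = some p'

/-- A strongly connected component of the transition graph that carries a cycle. -/
structure IsNontrivialComponent (M : PartialDFA.{u} Bool) (C : Set M.State) : Prop where
  exists_stays : ∀ p ∈ C, ∃ c, M.Stays C c p
  mem_of_step : ∀ {p p' p'' c}, p ∈ C → M.step p c = some p' → M.Reaches p' p'' → p'' ∈ C → p' ∈ C
  reaches : ∀ p ∈ C, ∀ p' ∈ C, M.Reaches p p'

open Classical in
/-- The direction in which a path proceeds from `p` that stays in `C` and keeps as far as possible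
to the side `e`. -/
noncomputable def direction (M : PartialDFA.{u} Bool) (C : Set M.State) (e : Bool) (p : M.State) :
    Bool :=
  if M.Stays C e p then e else !e

/-- `M.Exit C e p w` says that `w` is accepted from `p` and leaves the outermost path in `C` on the
side `e`, on that same side. At a state where this path could proceed in the direction `e`, no word
leaves it on the side `e`. -/
def Exit (M : PartialDFA.{u} Bool) (C : Set M.State) (e : Bool) : M.State → List Bool → Prop
  | p, [] => p ∈ M.accept ∧ ¬ M.Stays C e p
  | p, c :: x => ∃ p', M.step p c = some p' ∧
      (c = M.direction C e p ∧ M.Exit C e p' x ∨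
        c = e ∧ ¬ M.Stays C e p ∧ x ∈ M.languageFrom p')

/-- The states from which one can stay in `C` in both directions. -/
def branching (M : PartialDFA.{u} Bool) (C : Set M.State) : Set M.State :=
  {p | p ∈ C ∧ ∀ c, M.Stays C c p}

/-- The words accepted from a branching state `p` that are not separated from the empty word by a
word leading from `p` to another branching state. -/
def block (M : PartialDFA.{u} Bool) (C : Set M.State) (p : M.State) : Set (List Bool) :=
  {w | (w = [] ∧ p ∈ M.accept) ∨
    ∃ c p' x, M.step p c = some p' ∧ M.Exit C (!c) p' x ∧ w = c :: x}

/-- The words accepted from `q` that lie between the two outermost paths in `C`. -/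
def interior (M : PartialDFA.{u} Bool) (C : Set M.State) (q : M.State) : Set (List Bool) :=
  {w ∈ M.languageFrom q | ∀ e, ¬ M.Exit C e q w}

section Component

variable {C : Set M.State} {p q : M.State} {c e : Bool} {u v w x y : List Bool}

theorem Stays.mem_of_step (h : M.Stays C c p) (hq : M.step p c = some q) : q ∈ C := by
  obtain ⟨p', hp', hstep⟩ := h
  obtain rfl : q = p' := Option.some_injective _ (hq.symm.trans hstep)
  exact hp'

theorem direction_eq_self_iff : M.direction C e p = e ↔ M.Stays C e p := by
  by_cases h : M.Stays C e p <;> simp [direction, h]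

theorem direction_eq_not_iff : M.direction C e p = (!e) ↔ ¬ M.Stays C e p := by
  rw [← direction_eq_self_iff, Bool.eq_not]

theorem Exit.mem_languageFrom (h : M.Exit C e q w) : w ∈ M.languageFrom q := by
  induction w generalizing q with
  | nil => exact nil_mem_languageFrom.2 h.1
  | cons c w ih =>
    obtain ⟨p, hp, ⟨-, h⟩ | ⟨-, -, h⟩⟩ := h
    · exact cons_mem_languageFrom.2 ⟨p, hp, ih h⟩
    · exact cons_mem_languageFrom.2 ⟨p, hp, h⟩

theorem mem_languageFrom_of_mem_block (h : w ∈ M.block C p) : w ∈ M.languageFrom p := by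
  obtain ⟨rfl, h⟩ | ⟨c, p', x, hp', h, rfl⟩ := h
  · exact nil_mem_languageFrom.2 h
  · exact cons_mem_languageFrom.2 ⟨p', hp', h.mem_languageFrom⟩

theorem Exit.sideLT (hw : M.Exit C e q w) (hu : u ∈ M.languageFrom q) (hnot : ¬ M.Exit C e q u) :
    SideLT e u w := by
  induction w generalizing q u with
  | nil =>
    rcases u with _ | ⟨c, u⟩
    · exact absurd hw hnot
    · obtain ⟨p, hp, hu⟩ := cons_mem_languageFrom.1 hu
      obtain rfl : c = !e := Bool.eq_not.2 fun hc => hnot ⟨p, hp, Or.inr ⟨hc, hw.2, hu⟩⟩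
      exact sideLT_not_cons_of_head (by simp) u
  | cons d w ih =>
    obtain ⟨p, hp, hw⟩ := hw
    rcases u with _ | ⟨c, u⟩
    · have hst : M.Stays C e q := by
        by_contra hst
        exact hnot ⟨nil_mem_languageFrom.1 hu, hst⟩
      obtain ⟨rfl, -⟩ | ⟨-, h, -⟩ := hw
      · rw [direction_eq_self_iff.2 hst]
        exact sideLT_cons_of_head (by simp) w
      · exact absurd hst h
    · by_cases hcd : c = d
      · subst hcd
        have hu := (cons_mem_languageFrom_of_step hp).1 hu
        obtain ⟨hd, hw⟩ | ⟨hd, hst, -⟩ := hw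
        · exact sideLT_cons.2 (ih hw hu fun h => hnot ⟨p, hp, Or.inl ⟨hd, h⟩⟩)
        · exact absurd ⟨p, hp, Or.inr ⟨hd, hst, hu⟩⟩ hnot
      · by_cases hde : d = e
        · exact hde ▸ sideLT_cons_of_head (by simpa using hcd) w
        · obtain ⟨hd, -⟩ := hw.resolve_right fun h => hde h.1
          have hst : ¬ M.Stays C e q := direction_eq_not_iff.1 (hd ▸ Bool.eq_not.2 hde)
          obtain ⟨p', hp', hu⟩ := cons_mem_languageFrom.1 hu
          have hce : c = e := (Bool.eq_not.2 hcd).trans (Bool.eq_not.2 (Ne.symm hde)).symm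
          exact absurd ⟨p', hp', Or.inr ⟨hce, hst, hu⟩⟩ hnot

theorem IsNontrivialComponent.stays_direction (hC : M.IsNontrivialComponent C) (hp : p ∈ C)
    (e : Bool) : M.Stays C (M.direction C e p) p := by
  by_cases h : M.Stays C e p
  · rwa [direction_eq_self_iff.2 h]
  · obtain ⟨c, hc⟩ := hC.exists_stays p hp
    obtain rfl : c = !e := Bool.eq_not.2 fun hce => h (hce ▸ hc)
    rwa [direction_eq_not_iff.2 h]

theorem Exit.not_exit_not (hC : M.IsNontrivialComponent C) (hq : q ∈ C) (h : M.Exit C e q w) :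
    ¬ M.Exit C (!e) q w := by
  induction w generalizing q with
  | nil => exact fun h' => h'.2 (direction_eq_not_iff.2 h.2 ▸ hC.stays_direction hq e)
  | cons c w ih =>
    rintro ⟨p, hp, h'⟩
    obtain ⟨p', hp', h⟩ := h
    obtain rfl : p' = p := Option.some_injective _ (hp'.symm.trans hp)
    obtain ⟨hd, h⟩ | ⟨rfl, hst, -⟩ := h
    · have hc : M.Stays C c q := hd ▸ hC.stays_direction hq e
      obtain ⟨-, h'⟩ | ⟨rfl, hst, -⟩ := h'
      · exact ih (hc.mem_of_step hp) h h'
      · exact hst hc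
    · obtain ⟨hd, -⟩ | ⟨hc, -⟩ := h'
      · exact hst (hd.symm ▸ hC.stays_direction hq (!c))
      · simp at hc

theorem Exit.of_append (hC : M.IsNontrivialComponent C) (hq : q ∈ C) (hp : p ∈ C)
    (hx : M.run q x = some p) (h : M.Exit C e q (x ++ w)) : M.Exit C e p w := by
  induction x generalizing q with
  | nil =>
    obtain rfl : q = p := Option.some_injective _ hx
    exact h
  | cons c x ih =>
    obtain ⟨q', hq', h⟩ := h
    rw [run_cons_of_step hq'] at hx
    have hq'C : q' ∈ C := hC.mem_of_step hq hq' ⟨x, hx⟩ hp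
    obtain ⟨-, h⟩ | ⟨rfl, hst, -⟩ := h
    · exact ih hq'C hx h
    · exact absurd ⟨q', hq'C, hq'⟩ hst

theorem not_exit_of_mem_block (hC : M.IsNontrivialComponent C) (hp : p ∈ M.branching C)
    (hv : v ∈ M.block C p) : ¬ M.Exit C e p v := by
  obtain ⟨rfl, -⟩ | ⟨c, p', x, hp', hx, rfl⟩ := hv
  · exact fun h => h.2 (hp.2 e)
  · rintro ⟨p'', hp'', ⟨rfl, h⟩ | ⟨-, hst, -⟩⟩
    · obtain rfl : p'' = p' := Option.some_injective _ (hp''.symm.trans hp')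
      rw [direction_eq_self_iff.2 (hp.2 e)] at hp' hx
      exact h.not_exit_not hC ((hp.2 e).mem_of_step hp') hx
    · exact hst (hp.2 e)

theorem exists_mem_block_of_mem_interior (hq : q ∈ C)
    (hw : w ∈ M.interior C q) :
    ∃ x, ∃ p ∈ M.branching C, M.run q x = some p ∧ ∃ v ∈ M.block C p, w = x ++ v := by
  induction w generalizing q with
  | nil =>
    have hacc := nil_mem_languageFrom.1 hw.1
    have hst (c) : M.Stays C c q := by
      by_contra hc
      exact hw.2 c ⟨hacc, hc⟩
    exact ⟨[], q, ⟨hq, hst⟩, rfl, [], Or.inl ⟨rfl, hacc⟩, rfl⟩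
  | cons c w ih =>
    obtain ⟨hwL, hexit⟩ := hw
    obtain ⟨q', hq', hwL'⟩ := cons_mem_languageFrom.1 hwL
    have hc : M.Stays C c q := by
      by_contra hc
      exact hexit c ⟨q', hq', Or.inr ⟨rfl, hc, hwL'⟩⟩
    by_cases hw : ∃ e, M.Exit C e q' w
    · obtain ⟨e, he⟩ := hw
      have hce : M.direction C e q ≠ c := fun h => hexit e ⟨q', hq', Or.inl ⟨h.symm, he⟩⟩
      obtain rfl : e = !c := Bool.eq_not.2 fun h =>
        hce (h ▸ direction_eq_self_iff.2 (h.symm ▸ hc))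
      have hnc : M.Stays C (!c) q := by
        by_contra hnc
        exact hce (by rw [direction_eq_not_iff.2 hnc, Bool.not_not])
      refine ⟨[], q, ⟨hq, fun d => ?_⟩, rfl, c :: w, Or.inr ⟨c, q', w, hq', he, rfl⟩, rfl⟩
      by_cases hd : d = c
      · exact hd ▸ hc
      · exact Bool.eq_not.2 hd ▸ hnc
    · obtain ⟨x, p, hp, hx, v, hv, rfl⟩ :=
        ih (hc.mem_of_step hq') ⟨hwL', fun e he => hw ⟨e, he⟩⟩
      exact ⟨c :: x, p, hp, (run_cons_of_step hq' x).trans hx, v, hv, rfl⟩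

theorem mem_interior_iff (hC : M.IsNontrivialComponent C) (hq : q ∈ C) :
    w ∈ M.interior C q ↔
      ∃ x, ∃ p ∈ M.branching C, M.run q x = some p ∧ ∃ v ∈ M.block C p, w = x ++ v := by
  refine ⟨exists_mem_block_of_mem_interior hq, ?_⟩
  rintro ⟨x, p, hp, hx, v, hv, rfl⟩
  exact ⟨(append_mem_languageFrom hx).2 (mem_languageFrom_of_mem_block hv),
    fun e h => not_exit_of_mem_block hC hp hv (h.of_append hC hq hp.1 hx)⟩

theorem sideLT_of_mem_block (hC : M.IsNontrivialComponent C) (hp : p ∈ M.branching C)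
    (hv : v ∈ M.block C p) (hq : q ∈ M.branching C) (hw : w ∈ M.block C q)
    (hy : M.run p (e :: y) = some q) : SideLT e v (e :: y ++ w) := by
  obtain ⟨rfl, -⟩ | ⟨c, p', x, hp', hx, rfl⟩ := hv
  · exact sideLT_cons_of_head (by simp) _
  by_cases hce : c = e
  · subst hce
    rw [run_cons_of_step hp'] at hy
    refine sideLT_cons.2 (sideLT_not.1 (hx.sideLT ?_ fun h => ?_))
    · exact (append_mem_languageFrom hy).2 (mem_languageFrom_of_mem_block hw)
    · exact not_exit_of_mem_block hC hq hw
        (h.of_append hC ((hp.2 c).mem_of_step hp') hq.1 hy)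
  · exact sideLT_cons_of_head (by simpa using hce) _

theorem inorder_append_of_mem_block {p₁ p₂ : M.State} (hC : M.IsNontrivialComponent C)
    (hxy : Inorder x y) (hx : M.run q x = some p₁) (hy : M.run q y = some p₂)
    (hp₁ : p₁ ∈ M.branching C) (hp₂ : p₂ ∈ M.branching C) (hv : v ∈ M.block C p₁)
    (hw : w ∈ M.block C p₂) : Inorder (x ++ v) (y ++ w) := by
  obtain ⟨z, x, y, rfl, rfl, hhead⟩ := exists_longest_common_prefix x y
  rw [Inorder.append_append_iff, Inorder.iff_of_head hhead] at hxy
  rw [run_append, Option.bind_eq_some_iff] at hx hy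
  obtain ⟨p, hz, hx⟩ := hx
  obtain ⟨p', hz', hy⟩ := hy
  obtain rfl : p = p' := Option.some_injective _ (hz.symm.trans hz')
  rw [List.append_assoc, List.append_assoc, Inorder.append_append_iff]
  rcases x with _ | ⟨c, x⟩ <;> rcases y with _ | ⟨d, y⟩
  · simp at hxy
  · obtain rfl : d = true := by simpa using hxy
    obtain rfl : p = p₁ := Option.some_injective _ hx
    exact sideLT_of_mem_block hC hp₁ hv hp₂ hw hy
  · obtain rfl : c = false := by simpa using hxy
    obtain rfl : p = p₂ := Option.some_injective _ hy
    exact sideLT_of_mem_block hC hp₂ hw hp₁ hv hx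
  · exact (Inorder.iff_of_head (by simpa using hhead)).2 (by simpa using hxy)

theorem setOf_exit_eq {p' : M.State} (hp' : M.step p (M.direction C e p) = some p') :
    {w | M.Exit C e p w} = {w ∈ M.languageFrom p | ¬ M.Stays C e p ∧ (!e) ∉ w.head?} ∪
      (M.direction C e p :: ·) '' {w | M.Exit C e p' w} := by
  ext (_ | ⟨c, w⟩)
  · simp only [Exit, nil_mem_languageFrom, Set.mem_union, Set.mem_ofPred_eq, Set.mem_image,
      List.head?_nil, Option.mem_def, reduceCtorEq, and_false, exists_false, not_false_eq_true,
      and_true, or_false]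
  constructor
  · rintro ⟨p'', hp'', ⟨rfl, h⟩ | ⟨rfl, hst, h⟩⟩
    · obtain rfl : p'' = p' := Option.some_injective _ (hp''.symm.trans hp')
      exact Or.inr ⟨w, h, rfl⟩
    · exact Or.inl ⟨cons_mem_languageFrom.2 ⟨p'', hp'', h⟩, hst, by simp⟩
  · rintro (⟨h, hst, hhead⟩ | ⟨w, h, hcw⟩)
    · obtain rfl : c = e := by simpa using hhead
      obtain ⟨p'', hp'', h⟩ := cons_mem_languageFrom.1 h
      exact ⟨p'', hp'', Or.inr ⟨rfl, hst, h⟩⟩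
    · obtain ⟨rfl, rfl⟩ := List.cons_eq_cons.1 hcw
      exact ⟨p', hp', Or.inl ⟨rfl, h⟩⟩

theorem finiteDescriptionOn_immediateExit
    (hfd : ∀ p ∈ C, ∀ c p', M.step p c = some p' → p' ∉ C →
      FiniteDescriptionOn.{u} (M.languageFrom p')) (hp : p ∈ C) (e : Bool) :
    FiniteDescriptionOn.{u} {w ∈ M.languageFrom p | ¬ M.Stays C e p ∧ (!e) ∉ w.head?} := by
  by_cases hst : M.Stays C e p
  · simpa [hst] using FiniteDescriptionOn.empty
  have hsplit : {w ∈ M.languageFrom p | ¬ M.Stays C e p ∧ (!e) ∉ w.head?} =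
      {w | w = [] ∧ p ∈ M.accept} ∪ {w ∈ M.languageFrom p | w.head? = some e} := by
    ext (_ | ⟨c, w⟩) <;> simp [hst, nil_mem_languageFrom]
  rw [hsplit]
  refine (FiniteDescriptionOn.sep_singleton _ _).union_side e
    (finiteDescriptionOn_sep_head fun p' hp' => hfd p hp e p' hp' fun h => hst ⟨p', h, hp'⟩) ?_
  rintro _ ⟨rfl, -⟩ (_ | ⟨c, y⟩) ⟨-, hy⟩
  · simp at hy
  · obtain rfl : c = e := by simpa using hy
    exact sideLT_cons_of_head (by simp) y

theorem finiteDescriptionOn_exit (hC : M.IsNontrivialComponent C)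
    (hfd : ∀ p ∈ C, ∀ c p', M.step p c = some p' → p' ∉ C →
      FiniteDescriptionOn.{u} (M.languageFrom p')) (hp : p ∈ C) (e : Bool) :
    FiniteDescriptionOn.{u} {w | M.Exit C e p w} := by
  choose next hnext hstep using fun p : C => hC.stays_direction p.2 e
  refine FiniteDescriptionOn.of_eq_union_image_cons (e := e)
    (X := fun p : C => {w | M.Exit C e p w}) (d := fun p => M.direction C e p)
    (f := fun p => ⟨next p, hnext p⟩) (fun p => setOf_exit_eq (hstep p))
    (fun p => finiteDescriptionOn_immediateExit hfd p.2 e) ?_ ⟨p, hp⟩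
  rintro p x ⟨-, hst, hx⟩ z
  rw [direction_eq_not_iff.2 hst]
  exact sideLT_not_cons_of_head hx z

theorem finiteDescriptionOn_block (hC : M.IsNontrivialComponent C)
    (hfd : ∀ p ∈ C, ∀ c p', M.step p c = some p' → p' ∉ C →
      FiniteDescriptionOn.{u} (M.languageFrom p')) (hp : p ∈ M.branching C) :
    FiniteDescriptionOn.{u} (M.block C p) := by
  choose next hnext hstep using hp.2
  have hsplit : M.block C p = ((false :: ·) '' {w | M.Exit C true (next false) w} ∪
      {w | w = [] ∧ p ∈ M.accept}) ∪ (true :: ·) '' {w | M.Exit C false (next true) w} := by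
    ext (_ | ⟨_ | _, w⟩) <;> simp [block, hstep]
  rw [hsplit]
  refine (((finiteDescriptionOn_exit hC hfd (hnext false) true).image_cons false).union
    (.sep_singleton _ _) ?_).union
      ((finiteDescriptionOn_exit hC hfd (hnext true) false).image_cons true) ?_
  · rintro _ ⟨x, -, rfl⟩ _ ⟨rfl, -⟩
    exact (Inorder.iff_of_head (by simp)).2 (by simp)
  · rintro _ (⟨x, -, rfl⟩ | ⟨rfl, -⟩) _ ⟨y, -, rfl⟩ <;>
      exact (Inorder.iff_of_head (by simp)).2 (by simp)

theorem finiteDescriptionOn_interior (hC : M.IsNontrivialComponent C)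
    (hfd : ∀ p ∈ C, ∀ c p', M.step p c = some p' → p' ∉ C →
      FiniteDescriptionOn.{u} (M.languageFrom p')) (hq : q ∈ C) :
    FiniteDescriptionOn.{u} (M.interior C q) := by
  let N := {a : List Bool × M.branching C // M.run q a.1 = some a.2.1}
  have hinterior : M.interior C q =
      {w | ∃ a : N, ∃ v ∈ M.block C a.1.2.1, w = a.1.1 ++ v} := by
    ext w
    rw [mem_interior_iff hC hq]
    constructor
    · rintro ⟨x, p, hp, hx, v, hv, rfl⟩
      exact ⟨⟨(x, ⟨p, hp⟩), hx⟩, v, hv, rfl⟩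
    · rintro ⟨⟨⟨x, p⟩, hx⟩, v, hv, rfl⟩
      exact ⟨x, p, p.2, hx, v, hv, rfl⟩
  rw [hinterior]
  obtain hN | hN := isEmpty_or_nonempty N
  · simpa using FiniteDescriptionOn.empty
  refine FiniteDescriptionOn.shuffle (b := fun p : M.branching C => M.block C p)
    (node := fun a : N => a.1.1) (fun p => finiteDescriptionOn_block hC hfd p.2) ?_
    (fun a => a.1.2) ?_ ?_
  · rintro ⟨⟨x, p⟩, hx⟩ ⟨⟨_, p'⟩, hx'⟩ rfl
    obtain rfl : p = p' := Subtype.ext (Option.some_injective _ (hx.symm.trans hx'))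
    rfl
  · rintro ⟨⟨x, p⟩, hx⟩ e p'
    obtain ⟨r, hr, hstep⟩ := p.2.2 e
    obtain ⟨z, hz⟩ := hC.reaches r hr p' p'.2.1
    have hrun : M.run q (x ++ e :: z) = some p'.1 := by
      rw [run_append, hx, Option.bind_some, run_cons_of_step hstep, hz]
    exact ⟨z, ⟨⟨(_, p'), hrun⟩, rfl, rfl⟩⟩
  · rintro ⟨⟨x, p⟩, hx⟩ ⟨⟨y, p'⟩, hy⟩ hxy v hv w hw
    exact inorder_append_of_mem_block hC hxy hx hy p.2 p'.2 hv hw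

theorem finiteDescriptionOn_of_mem_component (hC : M.IsNontrivialComponent C)
    (hfd : ∀ p ∈ C, ∀ c p', M.step p c = some p' → p' ∉ C →
      FiniteDescriptionOn.{u} (M.languageFrom p')) (hq : q ∈ C) :
    FiniteDescriptionOn.{u} (M.languageFrom q) := by
  have hsplit : M.languageFrom q =
      ({w | M.Exit C false q w} ∪ M.interior C q) ∪ {w | M.Exit C true q w} := by
    ext w
    refine ⟨fun hw => ?_, ?_⟩
    · by_cases h : ∃ e, M.Exit C e q w
      · obtain ⟨_ | _, he⟩ := h
        exacts [Or.inl (Or.inl he), Or.inr he]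
      · exact Or.inl (Or.inr ⟨hw, fun e he => h ⟨e, he⟩⟩)
    · rintro ((h | h) | h)
      exacts [h.mem_languageFrom, h.1, h.mem_languageFrom]
  rw [hsplit]
  refine ((finiteDescriptionOn_exit hC hfd hq false).union
    (finiteDescriptionOn_interior hC hfd hq) ?_).union
      (finiteDescriptionOn_exit hC hfd hq true) ?_
  · exact fun x hx y hy => Exit.sideLT hx hy.1 (hy.2 false)
  · rintro x (hx | hx) y hy
    · exact Exit.sideLT hy hx.mem_languageFrom (hx.not_exit_not hC hq)
    · exact Exit.sideLT hy hx.1 (hx.2 true)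

end Component

theorem isNontrivialComponent_of_cycle {p q : M.State} {c : Bool} (hp : M.step q c = some p)
    (hpq : M.Reaches p q) : M.IsNontrivialComponent {r | M.Reaches q r ∧ M.Reaches r q} where
  exists_stays := by
    rintro r ⟨hqr, x, hx⟩
    rcases x with _ | ⟨d, x⟩
    · obtain rfl : r = q := Option.some_injective _ hx
      exact ⟨c, p, ⟨.of_step hp, hpq⟩, hp⟩
    · rw [run, Option.bind_eq_some_iff] at hx
      obtain ⟨r', hr', hx⟩ := hx
      exact ⟨d, r', ⟨hqr.trans (.of_step hr'), x, hx⟩, hr'⟩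
  mem_of_step hr hstep hreach hr'' := ⟨hr.1.trans (.of_step hstep), hreach.trans hr''.2⟩
  reaches _ hr _ hr' := hr.2.trans hr'.1

theorem finiteDescriptionOn_languageFrom (q : M.State) :
    FiniteDescriptionOn.{u} (M.languageFrom q) := by
  induction hn : {p | M.Reaches q p}.ncard using Nat.strong_induction_on generalizing q with
  | _ n ih =>
  have hbelow (p) (hqp : M.Reaches q p) (hpq : ¬ M.Reaches p q) :
      FiniteDescriptionOn.{u} (M.languageFrom p) := by
    refine ih _ (hn ▸ Set.ncard_lt_ncard ⟨fun r hr => hqp.trans hr, fun h => hpq (h ?_)⟩) p rfl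
    exact Reaches.refl q
  by_cases hcycle : ∃ c p, M.step q c = some p ∧ M.Reaches p q
  · obtain ⟨c, p, hp, hpq⟩ := hcycle
    refine finiteDescriptionOn_of_mem_component (isNontrivialComponent_of_cycle hp hpq) ?_
      ⟨.refl q, .refl q⟩
    intro r hr d r' hr' hmem
    have hqr' : M.Reaches q r' := hr.1.trans (.of_step hr')
    exact hbelow r' hqr' fun h => hmem ⟨hqr', h⟩
  · exact finiteDescriptionOn_of_step fun c p hp =>
      hbelow p (.of_step hp) fun h => hcycle ⟨c, p, hp, h⟩

end PartialDFA

/-! ## Initial solutions of word problems -/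

namespace Arrangement

variable {Γ : Type} {U : Type u}

/-- The identity morphism of an arrangement. -/
def Hom.id (A : Arrangement.{u} Γ) : Hom A A := ⟨RelEmbedding.refl _, fun _ => rfl⟩

/-- The composition of morphisms of arrangements. -/
def Hom.comp {A B C : Arrangement.{u} Γ} (g : Hom B C) (f : Hom A B) : Hom A C :=
  ⟨f.toRelEmbedding.trans g.toRelEmbedding, fun x => (g.color_eq _).trans (f.color_eq x)⟩

theorem Hom.ext {A B : Arrangement.{u} Γ} {f g : Hom A B}
    (h : ∀ x, f.toRelEmbedding x = g.toRelEmbedding x) : f = g := by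
  obtain ⟨f, _⟩ := f
  obtain ⟨g, _⟩ := g
  congr
  exact RelEmbedding.ext h

section Eval

variable {A B C : U → Arrangement.{u} Γ} (c : Γ ⊕ U) {x y : (eval A c).carrier}

theorem evalMap_id (x : (eval A c).carrier) : evalMap (fun v => Hom.id (A v)) c x = x := by
  cases c <;> rfl

theorem evalMap_comp (g : ∀ v, Hom (B v) (C v)) (f : ∀ v, Hom (A v) (B v))
    (x : (eval A c).carrier) :
    evalMap (fun v => (g v).comp (f v)) c x = evalMap g c (evalMap f c x) := by
  cases c <;> rfl

/-- The action of a family of maps on the arrangements substituted for a letter or an unknown. -/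
def evalFun (f : ∀ v, (A v).carrier → (B v).carrier) :
    ∀ c : Γ ⊕ U, (eval A c).carrier → (eval B c).carrier
  | .inl _, x => x
  | .inr v, x => f v x

theorem evalMap_eq_evalFun (f : ∀ v, Hom (A v) (B v)) (x : (eval A c).carrier) :
    evalMap f c x = evalFun (fun v => (f v).toRelEmbedding) c x := by
  cases c <;> rfl

/-- A rank on the components of a family, extended to letters by zero. -/
def evalRank (d : ∀ v, (A v).carrier → ℕ) : ∀ c : Γ ⊕ U, (eval A c).carrier → ℕ
  | .inl _, _ => 0
  | .inr v, x => d v x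

/-- The variant of `evalFun` for maps that are only defined on elements of rank less than `n`. -/
def evalPartialFun (d : ∀ v, (A v).carrier → ℕ) {n : ℕ}
    (f : ∀ v x, d v x < n → (B v).carrier) :
    ∀ (c : Γ ⊕ U) (x : (eval A c).carrier), evalRank d c x < n → (eval B c).carrier
  | .inl _, x, _ => x
  | .inr v, x, h => f v x h

variable {d : ∀ v, (A v).carrier → ℕ} {n : ℕ} {f g : ∀ v, (A v).carrier → (B v).carrier}

theorem evalPartialFun_eq_evalFun (h : evalRank d c x < n) :
    evalPartialFun d (fun v x _ => f v x) c x h = evalFun f c x := by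
  cases c <;> rfl

theorem evalFun_congr (h : ∀ v x, d v x < n → f v x = g v x) (hx : evalRank d c x < n) :
    evalFun f c x = evalFun g c x := by
  cases c with
  | inl _ => rfl
  | inr v => exact h v x hx

theorem evalFun_lt (h : ∀ v x y, d v x < n → (A v).lt x y → (B v).lt (f v x) (f v y))
    (hx : evalRank d c x < n) (hxy : (eval A c).lt x y) :
    (eval B c).lt (evalFun f c x) (evalFun f c y) := by
  cases c with
  | inl _ => exact hxy.elim
  | inr v => exact h v x y hx hxy

theorem color_evalFun (h : ∀ v x, d v x < n → (B v).color (f v x) = (A v).color x)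
    (hx : evalRank d c x < n) : (eval B c).color (evalFun f c x) = (eval A c).color x := by
  cases c with
  | inl _ => rfl
  | inr v => exact h v x hx

end Eval

section Subst

variable {A B C : U → Arrangement.{u} Γ} {w : List (Γ ⊕ U)} {x y : (subst A w).carrier}

theorem substMap_id (x : (subst A w).carrier) : substMap (fun v => Hom.id (A v)) w x = x :=
  Sigma.ext rfl (heq_of_eq (evalMap_id _ _))

theorem substMap_comp (g : ∀ v, Hom (B v) (C v)) (f : ∀ v, Hom (A v) (B v))
    (x : (subst A w).carrier) :
    substMap (fun v => (g v).comp (f v)) w x = substMap g w (substMap f w x) :=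
  Sigma.ext rfl (heq_of_eq (evalMap_comp _ _ _ _))

/-- The action of a family of maps on a substituted word. -/
def substFun (f : ∀ v, (A v).carrier → (B v).carrier) (w : List (Γ ⊕ U))
    (x : (subst A w).carrier) : (subst B w).carrier :=
  ⟨x.1, evalFun f (w.get x.1) x.2⟩

theorem substMap_eq_substFun (f : ∀ v, Hom (A v) (B v)) (x : (subst A w).carrier) :
    substMap f w x = substFun (fun v => (f v).toRelEmbedding) w x :=
  Sigma.ext rfl (heq_of_eq (evalMap_eq_evalFun _ _ _))

/-- The rank on a substituted word that is induced by a rank on the components of a family. -/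
def substRank (d : ∀ v, (A v).carrier → ℕ) (w : List (Γ ⊕ U)) (x : (subst A w).carrier) : ℕ :=
  evalRank d (w.get x.1) x.2

variable {d : ∀ v, (A v).carrier → ℕ} {n : ℕ} {f g : ∀ v, (A v).carrier → (B v).carrier}

theorem substFun_congr (h : ∀ v x, d v x < n → f v x = g v x) (hx : substRank d w x < n) :
    substFun f w x = substFun g w x :=
  Sigma.ext rfl (heq_of_eq (evalFun_congr _ h hx))

theorem substFun_lt (h : ∀ v x y, d v x < n → (A v).lt x y → (B v).lt (f v x) (f v y))
    (hx : substRank d w x < n) (hxy : (subst A w).lt x y) :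
    (subst B w).lt (substFun f w x) (substFun f w y) := by
  rcases hxy with ⟨x, y, hlt⟩ | ⟨x, y, hlt⟩
  · exact .left _ _ hlt
  · exact .right _ _ (evalFun_lt _ h hx hlt)

theorem color_substFun (h : ∀ v x, d v x < n → (B v).color (f v x) = (A v).color x)
    (hx : substRank d w x < n) : (subst B w).color (substFun f w x) = (subst A w).color x :=
  color_evalFun _ h hx

end Subst

end Arrangement

namespace WordProblem

open Arrangement

variable {Γ : Type} {U : Type u} {W : WordProblem Γ U}

theorem IsSolutionHom.id (S : Solution W) : IsSolutionHom S S fun v => Hom.id (S.arr v) :=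
  fun _ _ => (substMap_id _).symm

theorem IsSolutionHom.comp {S T R : Solution W} {g : ∀ v, Hom (T.arr v) (R.arr v)}
    {f : ∀ v, Hom (S.arr v) (T.arr v)} (hg : IsSolutionHom T R g) (hf : IsSolutionHom S T f) :
    IsSolutionHom S R fun v => (g v).comp (f v) := by
  intro v x
  rw [substMap_comp, ← hf v x]
  exact hg v _

namespace Solution

theorem IsUniversal.nonempty_relIso {S T : Solution W} (hS : S.IsUniversal) (hT : T.IsUniversal)
    (v : U) : Nonempty ((S.arr v).lt ≃r (T.arr v).lt) := by
  obtain ⟨f, hf, -⟩ := hS T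
  obtain ⟨g, hg, -⟩ := hT S
  have hgf := (hS S).unique (hg.comp hf) (.id S)
  have hfg := (hT T).unique (hf.comp hg) (.id T)
  exact ⟨⟨⟨(f v).toRelEmbedding, (g v).toRelEmbedding,
    fun x => congrArg (fun h => (h v).toRelEmbedding x) hgf,
    fun x => congrArg (fun h => (h v).toRelEmbedding x) hfg⟩,
    (f v).toRelEmbedding.map_rel_iff⟩⟩

/-- A rank on the components of a solution that decreases under unfolding. -/
def IsRank (S : Solution W) (d : ∀ v, (S.arr v).carrier → ℕ) : Prop :=
  ∀ v x, substRank d (W v) ((S.iso v).toRelIso x) < d v x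

variable {S : Solution W} {d : ∀ v, (S.arr v).carrier → ℕ}

/-- The map between the components of two solutions that is defined by recursion on a rank. -/
noncomputable def lift (hd : S.IsRank d) (T : Solution W) :
    ∀ p : Σ v, (S.arr v).carrier, (T.arr p.1).carrier :=
  (measure fun p : Σ v, (S.arr v).carrier => d p.1 p.2).wf.fix fun p f =>
    (T.iso p.1).toRelIso.symm ⟨((S.iso p.1).toRelIso p.2).1,
      evalPartialFun d (fun v x h => f ⟨v, x⟩ h) _ ((S.iso p.1).toRelIso p.2).2 (hd p.1 p.2)⟩

variable (hd : S.IsRank d) (T : Solution W)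

theorem iso_lift (v : U) (x : (S.arr v).carrier) :
    (T.iso v).toRelIso (lift hd T ⟨v, x⟩) =
      substFun (fun v x => lift hd T ⟨v, x⟩) (W v) ((S.iso v).toRelIso x) := by
  rw [lift, WellFounded.fix_eq]
  refine (RelIso.apply_symm_apply _ _).trans (congrArg (Sigma.mk _) ?_)
  exact evalPartialFun_eq_evalFun (f := fun v x => lift hd T ⟨v, x⟩) _ (hd v x)

theorem lift_lt {v : U} {x y : (S.arr v).carrier} (h : (S.arr v).lt x y) :
    (T.arr v).lt (lift hd T ⟨v, x⟩) (lift hd T ⟨v, y⟩) := by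
  induction hn : d v x using Nat.strong_induction_on generalizing v with
  | _ n ih =>
    subst hn
    rw [← (T.iso v).toRelIso.map_rel_iff, iso_lift, iso_lift]
    exact substFun_lt (d := d) (fun p x y hx h => ih _ hx h rfl) (hd v x)
      ((S.iso v).toRelIso.map_rel_iff.2 h)

theorem color_lift (v : U) (x : (S.arr v).carrier) :
    (T.arr v).color (lift hd T ⟨v, x⟩) = (S.arr v).color x := by
  induction hn : d v x using Nat.strong_induction_on generalizing v with
  | _ n ih =>
    subst hn
    rw [← (T.iso v).color_eq, iso_lift, ← (S.iso v).color_eq]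
    exact color_substFun (d := d) (fun p x hx => ih _ hx p x rfl) (hd v x)

theorem eq_lift {T : Solution W} {f : ∀ v, Hom (S.arr v) (T.arr v)} (hf : IsSolutionHom S T f)
    (v : U) (x : (S.arr v).carrier) : (f v).toRelEmbedding x = lift hd T ⟨v, x⟩ := by
  induction hn : d v x using Nat.strong_induction_on generalizing v with
  | _ n ih =>
    subst hn
    apply (T.iso v).toRelIso.injective
    rw [hf, iso_lift, substMap_eq_substFun]
    exact substFun_congr (d := d) (fun p x hx => ih _ hx p x rfl) (hd v x)

theorem IsRank.isUniversal (hd : S.IsRank d) : S.IsUniversal := by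
  intro T
  have := fun v => (S.arr v).isStrictTotalOrder
  have := fun v => (T.arr v).isStrictTotalOrder
  let F (v) : Hom (S.arr v) (T.arr v) :=
    ⟨.ofMonotone (fun x => lift hd T ⟨v, x⟩) fun _ _ h => lift_lt hd T h, color_lift hd T v⟩
  refine ⟨F, fun v x => ?_, fun f hf => funext fun v => Hom.ext (eq_lift hd hf v)⟩
  rw [substMap_eq_substFun]
  exact iso_lift hd T v x

end Solution

end WordProblem

/-! ## The languages of an automaton as the universal solution of its word problem -/

namespace PartialDFA

open Arrangement

variable {M : PartialDFA.{u} Bool}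

/-- The words accepted from a state, as an arrangement. -/
def arrangement (M : PartialDFA.{u} Bool) (q : M.State) : Arrangement.{u} Unit where
  carrier := ULift (M.languageFrom q)
  lt := InorderOn _
  isStrictTotalOrder := inferInstance
  color _ := ()

/-- The rank of an accepted word. It is positive because letters have rank zero. -/
def arrangementRank (M : PartialDFA.{u} Bool) (q : M.State) (x : (M.arrangement q).carrier) : ℕ :=
  (ULift.down x).1.length + 1

/-- The entries of the right-hand side of the equation of the state `q` in the word problem of `M`:
`IsEntry q none c` says that the entry `c` stands for the empty word, and `IsEntry q (some b) c`
that `c` stands for the words that begin with `b`. -/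
inductive IsEntry (q : M.State) : Option Bool → Unit ⊕ M.State → Prop
  | letter : q ∈ M.accept → IsEntry q none (.inl ())
  | unknown {b : Bool} {p : M.State} : M.step q b = some p → IsEntry q (some b) (.inr p)

/-- The word accepted from a state that corresponds to an element of the arrangement substituted
for an entry of its equation. -/
def entryWord : Option Bool → ∀ c : Unit ⊕ M.State, (eval M.arrangement c).carrier → List Bool
  | some b, .inr _, x => b :: x.down.1
  | _, _, _ => []

namespace IsEntry

variable {q : M.State} {o o' : Option Bool} {c c' : Unit ⊕ M.State}

theorem entryWord_mem (h : IsEntry q o c) (x : (eval M.arrangement c).carrier) :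
    entryWord o c x ∈ M.languageFrom q := by
  cases h with
  | letter h => exact nil_mem_languageFrom.2 h
  | unknown h => exact (cons_mem_languageFrom_of_step h).2 x.down.2

theorem head?_entryWord (h : IsEntry q o c) (x : (eval M.arrangement c).carrier) :
    (entryWord o c x).head? = o := by
  cases h <;> rfl

theorem inorder_entryWord_of_ne (h : IsEntry q o c) (h' : IsEntry q o' c') (hne : o ≠ o')
    (hlt : o = some false ∨ o' = some true) (x : (eval M.arrangement c).carrier)
    (y : (eval M.arrangement c').carrier) : Inorder (entryWord o c x) (entryWord o' c' y) := by
  rw [Inorder.iff_of_head, h.head?_entryWord, h'.head?_entryWord]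
  · exact hlt
  · rw [h.head?_entryWord, h'.head?_entryWord]
    rintro a rfl ha
    exact hne ha.symm

theorem inorder_entryWord (h : IsEntry q o c) {x y : (eval M.arrangement c).carrier}
    (hxy : (eval M.arrangement c).lt x y) : Inorder (entryWord o c x) (entryWord o c y) := by
  cases h with
  | letter => exact hxy.elim
  | unknown => exact Inorder.cons_cons_iff.2 hxy

theorem evalRank_lt (h : IsEntry q o c) (x : (eval M.arrangement c).carrier) :
    evalRank M.arrangementRank c x < (entryWord o c x).length + 1 := by
  cases h <;> exact Nat.lt_succ_self _

theorem exists_entryWord_eq {w : List Bool} (hw : w ∈ M.languageFrom q) :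
    ∃ o c, IsEntry q o c ∧ ∃ x, entryWord o c x = w := by
  rcases w with _ | ⟨b, w⟩
  · exact ⟨none, _, .letter (nil_mem_languageFrom.1 hw), PUnit.unit, rfl⟩
  · obtain ⟨p, hp, hw⟩ := cons_mem_languageFrom.1 hw
    exact ⟨some b, .inr p, .unknown hp, ⟨w, hw⟩, rfl⟩

end IsEntry

open Classical in
/-- The right-hand side of the equation of the state `q` in the word problem of `M`, with each entry
labelled as in `IsEntry`. -/
noncomputable def labelledEntries (M : PartialDFA.{u} Bool) (q : M.State) :
    List (Option Bool × (Unit ⊕ M.State)) :=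
  (M.step q false).toList.map (fun p => (some false, .inr p)) ++
    (if q ∈ M.accept then [(none, .inl ())] else []) ++
      (M.step q true).toList.map fun p => (some true, .inr p)

theorem map_snd_labelledEntries (q : M.State) :
    (M.labelledEntries q).map Prod.snd = M.wordProblem q := by
  unfold labelledEntries wordProblem
  split_ifs <;> simp [Function.comp_def]

theorem mem_labelledEntries {q : M.State} {o : Option Bool} {c : Unit ⊕ M.State} :
    (o, c) ∈ M.labelledEntries q ↔ IsEntry q o c := by
  simp only [labelledEntries, List.mem_append, List.mem_map, Option.mem_toList, Prod.mk.injEq]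
  constructor
  · rintro ((⟨p, hp, rfl, rfl⟩ | h) | ⟨p, hp, rfl, rfl⟩)
    · exact .unknown hp
    · split_ifs at h with hq
      · obtain ⟨rfl, rfl⟩ := Prod.mk.inj (List.mem_singleton.1 h)
        exact .letter hq
      · simp at h
    · exact .unknown hp
  · rintro (h | @⟨_ | _, p, h⟩)
    · simp [h]
    · exact Or.inl (Or.inl ⟨p, h, rfl, rfl⟩)
    · exact Or.inr ⟨p, h, rfl, rfl⟩

theorem pairwise_labelledEntries (q : M.State) :
    (M.labelledEntries q).Pairwise fun a b =>
      a.1 ≠ b.1 ∧ (a.1 = some false ∨ b.1 = some true) := by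
  unfold labelledEntries
  cases M.step q false <;> cases M.step q true <;> split_ifs <;> simp

theorem exists_entry_labels (q : M.State) : ∃ o : Fin (M.wordProblem q).length → Option Bool,
    (∀ i, IsEntry q (o i) ((M.wordProblem q).get i)) ∧
    (∀ i j, i < j → o i ≠ o j ∧ (o i = some false ∨ o j = some true)) ∧
    ∀ a c, IsEntry q a c → ∃ i, o i = a ∧ (M.wordProblem q).get i = c := by
  have hmap := map_snd_labelledEntries q
  generalize M.wordProblem q = w at hmap
  subst hmap
  refine ⟨fun i => ((M.labelledEntries q).get (i.cast (List.length_map _))).1, fun i => ?_,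
    fun i j hij => (pairwise_labelledEntries q).rel_get_of_lt hij, fun a c h => ?_⟩
  · rw [List.get_eq_getElem, List.getElem_map]
    exact mem_labelledEntries.1 (List.get_mem _ _)
  · obtain ⟨i, hi⟩ := List.get_of_mem (mem_labelledEntries.2 h)
    refine ⟨i.cast (List.length_map _).symm, congrArg Prod.fst hi, ?_⟩
    rw [List.get_eq_getElem, List.getElem_map]
    exact congrArg Prod.snd hi

theorem exists_iso_subst (q : M.State) :
    ∃ e : Arrangement.Iso (M.arrangement q) (subst M.arrangement (M.wordProblem q)),
      ∀ x, substRank M.arrangementRank _ (e.toRelIso x) < M.arrangementRank q x := by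
  obtain ⟨o, hentry, hlt, hall⟩ := exists_entry_labels q
  have := (subst M.arrangement (M.wordProblem q)).isStrictTotalOrder
  have := (M.arrangement q).isStrictTotalOrder
  let g : (subst M.arrangement (M.wordProblem q)).lt ↪r (M.arrangement q).lt :=
    .ofMonotone (fun x => ⟨entryWord (o x.1) _ x.2, (hentry x.1).entryWord_mem x.2⟩) (by
      rintro _ _ (⟨x, y, h⟩ | ⟨x, y, h⟩)
      · exact (hentry _).inorder_entryWord_of_ne (hentry _) (hlt _ _ h).1 (hlt _ _ h).2 x y
      · exact (hentry _).inorder_entryWord h)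
  have hg : Function.Surjective g := by
    rintro ⟨w, hw⟩
    obtain ⟨a, c, hac, x, rfl⟩ := IsEntry.exists_entryWord_eq hw
    obtain ⟨i, rfl, rfl⟩ := hall a c hac
    exact ⟨⟨i, x⟩, rfl⟩
  refine ⟨⟨(RelIso.ofSurjective g hg).symm, fun _ => rfl⟩, fun y => ?_⟩
  obtain ⟨x, rfl⟩ := (RelIso.ofSurjective g hg).surjective y
  rw [RelIso.symm_apply_apply]
  exact (hentry x.1).evalRank_lt x.2

variable (M) in
theorem exists_isUniversal_arr_eq : ∃ S : WordProblem.Solution M.wordProblem,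
    S.IsUniversal ∧ S.arr = M.arrangement := by
  choose e he using M.exists_iso_subst
  exact ⟨⟨M.arrangement, e⟩, WordProblem.Solution.IsRank.isUniversal he, rfl⟩

variable (M) in
theorem isFiniteDescription_arrangement (q : M.State) :
    IsFiniteDescription (M.arrangement q).lt :=
  finiteDescriptionOn_languageFrom q

end PartialDFA

/-! ## Strings and the automaton of a hammock -/

theorem longest_common_suffix_iff {α : Type*} {w x y : List α} :
    (∀ u, u <:+ x ++ w → u <:+ y ++ w → u.length ≤ w.length) ↔
      ∀ a ∈ x.getLast?, a ∉ y.getLast? := by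
  rw [← List.head?_reverse, ← List.head?_reverse,
    ← longest_common_prefix_iff (w := w.reverse), ← List.reverse_append, ← List.reverse_append,
    List.reverse_surjective.forall]
  simp only [← List.reverse_prefix, List.reverse_reverse, List.length_reverse]

theorem exists_longest_common_suffix {α : Type*} (x y : List α) :
    ∃ w x' y', x = x' ++ w ∧ y = y' ++ w ∧ ∀ a ∈ x'.getLast?, a ∉ y'.getLast? := by
  obtain ⟨w, x', y', hx, hy, h⟩ := exists_longest_common_prefix x.reverse y.reverse
  refine ⟨w.reverse, x'.reverse, y'.reverse, ?_, ?_, by simpa only [List.getLast?_reverse]⟩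
  · rw [← List.reverse_append, ← hx, List.reverse_reverse]
  · rw [← List.reverse_append, ← hy, List.reverse_reverse]

namespace StringAlgebra

open PreWalk

variable {V E : Type u} {Λ : StringAlgebra V E}

namespace Syllable

theorem inv_inv (α : Syllable E) : α.inv.inv = α := by cases α <;> rfl

theorem s_inv (α : Syllable E) : α.inv.s Λ = α.t Λ := by cases α <;> rfl

theorem t_inv (α : Syllable E) : α.inv.t Λ = α.s Λ := by cases α <;> rfl

theorem σ_inv (ε : Λ.Signs) (α : Syllable E) : α.inv.σ ε = α.τ ε := by cases α <;> rfl

theorem map_sgn_eq_some_false {o : Option (Syllable E)} :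
    o.map sgn = some false ↔ ∃ a, o = some (direct a) := by
  rcases o with _ | _ | _ <;> simp [sgn]

theorem map_sgn_eq_some_true {o : Option (Syllable E)} :
    o.map sgn = some true ↔ ∃ a, o = some (inverse a) := by
  rcases o with _ | _ | _ <;> simp [sgn]

theorem eq_of_s_eq_of_σ_eq (ε : Λ.Signs) {β β' : Syllable E} (hs : β.s Λ = β'.s Λ)
    (hσ : β.σ ε = β'.σ ε) (hsgn : β.sgn = β'.sgn) : β = β' := by
  by_contra hne
  refine units_ne_neg_self (β'.σ ε) (hσ.symm.trans ?_)
  rcases β with b | b <;> rcases β' with b' | b' <;> simp only [sgn, reduceCtorEq] at hsgn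
  · exact ε.source b b' (fun h => hne (congrArg _ h)) hs
  · exact ε.target b b' (fun h => hne (congrArg _ h)) hs

end Syllable

theorem eq_of_encard_le_two {α : Type*} {S : Set α} (hS : S.encard ≤ 2) {a b c : α} (ha : a ∈ S)
    (hb : b ∈ S) (hc : c ∈ S) (hac : a ≠ c) (hbc : b ≠ c) : a = b := by
  by_contra hab
  have hle : ({a, b, c} : Set α).encard ≤ 2 :=
    (Set.encard_le_encard (by rintro _ (rfl | rfl | rfl) <;> assumption)).trans hS
  rw [Set.encard_eq_three.2 ⟨a, b, c, hab, hac, hbc, rfl⟩] at hle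
  exact absurd hle (by decide)

variable {ε : Λ.Signs} {v : V} {i : ℤˣ} {c : Bool} {α β β' : Syllable E}
  {l w x' y' : List (Syllable E)} {x y z z' : PreWalk V E}

namespace PreWalk

theorem isString_one (v : V) (i : ℤˣ) : (one v i : PreWalk V E).IsString Λ where
  isWalk := List.isChain_nil
  no_rel p hp h := by
    have := Λ.two_le_length p hp
    simp_all [toList]
  no_inv_rel p hp h := by
    have := Λ.two_le_length p hp
    simp_all [toList]
  reduced := List.isChain_nil

theorem IsString.of_infix (hx : x.IsString Λ) (h : y.toList <:+: x.toList) : y.IsString Λ where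
  isWalk := hx.isWalk.infix h
  no_rel p hp hy := hx.no_rel p hp (hy.trans h)
  no_inv_rel p hp hy := hx.no_inv_rel p hp (hy.trans h)
  reduced := hx.reduced.infix h

theorem isConcat_one_left_iff : IsConcat ε (one v i) x x ↔ x.t Λ = v ∧ x.τ ε = i := by
  constructor
  · rintro (⟨_, _, _, ht, hτ⟩ | _)
    exacts [⟨ht, hτ⟩, ⟨rfl, rfl⟩]
  · rintro ⟨ht, hτ⟩
    exact .one_left _ _ _ ht hτ

theorem isConcat_one_right_iff : IsConcat ε x (one v i) x ↔ x.s Λ = v ∧ x.σ ε = -i := by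
  constructor
  · rintro (_ | ⟨_, _, _, hs, hσ⟩)
    exacts [⟨rfl, rfl⟩, ⟨hs, hσ⟩]
  · rintro ⟨hs, hσ⟩
    exact .one_right _ _ _ hs hσ

theorem isConcat_syllable_one_iff :
    IsConcat ε (word β []) (one v i) z ↔ z = word β [] ∧ β.s Λ = v ∧ β.σ ε = -i := by
  constructor
  · rintro (_ | ⟨_, _, _, hs, hσ⟩ | _)
    exact ⟨rfl, hs, hσ⟩
  · rintro ⟨rfl, hs, hσ⟩
    exact .one_right _ _ _ hs hσ

theorem isConcat_syllable_word_iff :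
    IsConcat ε (word β []) (word α l) z ↔ z = word β (α :: l) := by
  constructor
  · rintro (_ | _ | _)
    rfl
  · rintro rfl
    exact .word _ _ _ _

theorem IsConcat.toList_eq (h : IsConcat ε (PreWalk.word β []) x z) :
    z.toList = β :: x.toList := by
  rcases x with _ | _
  · rw [(isConcat_syllable_one_iff.1 h).1]
    rfl
  · rw [isConcat_syllable_word_iff.1 h]
    rfl

theorem IsConcat.unique (h : IsConcat ε (PreWalk.word β []) x z)
    (h' : IsConcat ε (PreWalk.word β []) x z') : z = z' := by
  rcases x with _ | _
  · rw [(isConcat_syllable_one_iff.1 h).1, (isConcat_syllable_one_iff.1 h').1]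
  · rw [isConcat_syllable_word_iff.1 h, isConcat_syllable_word_iff.1 h']

/-! ### Prepending syllables to strings -/

theorem IsString.syllable_eq_of_sgn_eq (h : (word β (α :: l) : PreWalk V E).IsString Λ)
    (h' : (word β' (α :: l) : PreWalk V E).IsString Λ) (hsgn : β.sgn = β'.sgn) : β = β' := by
  have hw := (List.isChain_cons_cons.1 h.isWalk).1
  have hw' := (List.isChain_cons_cons.1 h'.isWalk).1
  have hr := (List.isChain_cons_cons.1 h.reduced).1
  have hr' := (List.isChain_cons_cons.1 h'.reduced).1
  have hinfix (γ : Syllable E) : [γ, α] <:+: γ :: α :: l := (List.prefix_append [γ, α] l).isInfix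
  rcases β with b | b <;> rcases β' with b' | b' <;>
    simp only [Syllable.sgn, reduceCtorEq] at hsgn <;> congr 1 <;> rcases α with a | a <;>
    simp only [Syllable.s, Syllable.t, Syllable.inv, ne_eq, Syllable.direct.injEq,
      Syllable.inverse.injEq] at hw hw' hr hr'
  · exact Λ.left_unique a b b' hw hw' (fun hp => h.no_rel _ hp (hinfix _))
      fun hp => h'.no_rel _ hp (hinfix _)
  · exact eq_of_encard_le_two (Λ.encard_source_le (Λ.s a)) hw hw' rfl hr hr'
  · exact eq_of_encard_le_two (Λ.encard_target_le (Λ.t a)) hw hw' rfl hr hr'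
  · exact Λ.right_unique a b b' hw.symm hw'.symm (fun hp => h.no_inv_rel _ hp (hinfix _))
      fun hp => h'.no_inv_rel _ hp (hinfix _)

theorem truncate_word_cons (β α : Syllable E) (l : List (Syllable E)) :
    (word β (α :: l.take (Λ.maxRelLength - 2)) : PreWalk V E).truncate Λ =
      (word β (α :: l)).truncate Λ := by
  simp only [truncate]
  cases Λ.maxRelLength - 2 with
  | zero => rfl
  | succ k => simp [List.take_take]

theorem isString_word_cons_iff (hx : (word α l : PreWalk V E).IsString Λ) :
    (word β (α :: l) : PreWalk V E).IsString Λ ↔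
      (word β (α :: l.take (Λ.maxRelLength - 2)) : PreWalk V E).IsString Λ := by
  have hpre : β :: α :: l.take (Λ.maxRelLength - 2) <+: β :: α :: l := by
    simpa using List.take_prefix _ _
  refine ⟨fun h => h.of_infix hpre.isInfix, fun h => ?_⟩
  have infix_of_length_le {m : List (Syllable E)} (hm : m.length ≤ Λ.maxRelLength)
      (hml : m <+: β :: α :: l) : m <:+: β :: α :: l.take (Λ.maxRelLength - 2) := by
    refine (List.prefix_of_prefix_length_le hml hpre ?_).isInfix
    have hr : 2 ≤ Λ.maxRelLength := le_max_left _ _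
    have := hml.length_le
    simp only [List.length_cons, List.length_take] at this ⊢
    omega
  have length_le {p : List E} (hp : p ∈ Λ.rel) : p.length ≤ Λ.maxRelLength :=
    (Finset.le_sup (f := List.length) hp).trans (le_max_right _ _)
  refine ⟨List.isChain_cons_cons.2 ⟨(List.isChain_cons_cons.1 h.isWalk).1, hx.isWalk⟩,
    fun p hp hpx => ?_, fun p hp hpx => ?_,
    List.isChain_cons_cons.2 ⟨(List.isChain_cons_cons.1 h.reduced).1, hx.reduced⟩⟩
  · rcases List.infix_cons_iff.1 hpx with hpx | hpx
    · exact h.no_rel p hp (infix_of_length_le (by simpa using length_le hp) hpx)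
    · exact hx.no_rel p hp hpx
  · rcases List.infix_cons_iff.1 hpx with hpx | hpx
    · exact h.no_inv_rel p hp (infix_of_length_le (by simpa using length_le hp) hpx)
    · exact hx.no_inv_rel p hp hpx

end PreWalk

theorem IsExtension.unique (h : IsExtension ε x c z) (h' : IsExtension ε x c z') : z = z' := by
  obtain ⟨hz, β, rfl, h⟩ := h
  obtain ⟨hz', β', hsgn, h'⟩ := h'
  suffices β = β' from h.unique (this ▸ h')
  rcases x with _ | _
  · obtain ⟨-, hs, hσ⟩ := isConcat_syllable_one_iff.1 h
    obtain ⟨-, hs', hσ'⟩ := isConcat_syllable_one_iff.1 h'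
    exact Syllable.eq_of_s_eq_of_σ_eq ε (hs.trans hs'.symm) (hσ.trans hσ'.symm) hsgn.symm
  · rw [isConcat_syllable_word_iff] at h h'
    subst h h'
    exact hz.syllable_eq_of_sgn_eq hz' hsgn.symm

theorem IsExtension.exists_toList_eq (h : IsExtension ε x c z) :
    ∃ β : Syllable E, β.sgn = c ∧ z.toList = β :: x.toList := by
  obtain ⟨-, β, hβ, h⟩ := h
  exact ⟨β, hβ, h.toList_eq⟩

theorem IsExtension.sgn_eq (h : IsExtension ε x c z) : z.sgn = x.sgn ++ [c] := by
  obtain ⟨β, rfl, hz⟩ := h.exists_toList_eq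
  simp only [sgn, hz, List.map_cons, List.reverse_cons]

theorem exists_isExtension_truncate_iff (hx : x.IsString Λ) :
    (∃ z, IsExtension ε (x.truncate Λ) c z ∧ y = z.truncate Λ) ↔
      ∃ z, IsExtension ε x c z ∧ y = z.truncate Λ := by
  rcases x with _ | ⟨α, l⟩
  · rfl
  · constructor
    · rintro ⟨_, ⟨hz, β, hβ, h⟩, rfl⟩
      obtain rfl := isConcat_syllable_word_iff.1 h
      exact ⟨_, ⟨(isString_word_cons_iff hx).2 hz, β, hβ, isConcat_syllable_word_iff.2 rfl⟩,
        truncate_word_cons β α l⟩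
    · rintro ⟨_, ⟨hz, β, hβ, h⟩, rfl⟩
      obtain rfl := isConcat_syllable_word_iff.1 h
      exact ⟨_, ⟨(isString_word_cons_iff hx).1 hz, β, hβ, isConcat_syllable_word_iff.2 rfl⟩,
        (truncate_word_cons β α l).symm⟩

/-! ### Strings with a given right end -/

/-- The strings `x` such that `x 1_(v,i)` is defined, which for `i = 1` form the left hammock at
`v` and for `i = -1` are the inverses of the strings in the right hammock. -/
def stringsAt (ε : Λ.Signs) (v : V) (i : ℤˣ) : Set (PreWalk V E) :=
  {x | x.IsString Λ ∧ x.s Λ = v ∧ x.σ ε = -i}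

/-- The order `<_l` on the strings `x` such that `x 1_(v,i)` is defined. -/
def stringsAt.lt (ε : Λ.Signs) (v : V) (i : ℤˣ) (x y : stringsAt ε v i) : Prop := x.1.LtL y.1

theorem mem_stringsAt_iff : x ∈ stringsAt ε v i ↔
    x = one v i ∨ ∃ y ∈ stringsAt ε v i, ∃ c, IsExtension ε y c x := by
  rcases x with ⟨v', j⟩ | ⟨β, _ | ⟨α, l⟩⟩
  · constructor
    · rintro ⟨-, hs, hσ⟩
      exact Or.inl (congrArg₂ one hs (neg_injective hσ))
    · rintro (h | ⟨y, -, c, h⟩)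
      · exact h ▸ ⟨isString_one v i, rfl, rfl⟩
      · obtain ⟨_, -, hnil⟩ := h.exists_toList_eq
        exact absurd hnil (List.cons_ne_nil _ _).symm
  · constructor
    · rintro ⟨hx, hs, hσ⟩
      exact Or.inr ⟨one v i, ⟨isString_one v i, rfl, rfl⟩, _, hx, β, rfl,
        isConcat_syllable_one_iff.2 ⟨rfl, hs, hσ⟩⟩
    · rintro (h | ⟨⟨v', j⟩ | ⟨α, l⟩, ⟨-, rfl, hσ⟩, c, hx, β', -, h⟩)
      · cases h
      · obtain ⟨h, hs, hσ'⟩ := isConcat_syllable_one_iff.1 h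
        cases h
        exact ⟨hx, hs, hσ'.trans hσ⟩
      · cases isConcat_syllable_word_iff.1 h
  · constructor
    · rintro ⟨hx, hs, hσ⟩
      exact Or.inr ⟨word α l, ⟨hx.of_infix (List.suffix_cons _ _).isInfix, hs, hσ⟩, _, hx, β, rfl,
        isConcat_syllable_word_iff.2 rfl⟩
    · rintro (h | ⟨⟨v', j⟩ | ⟨α, l⟩, ⟨-, hs, hσ⟩, c, hx, β', -, h⟩)
      · cases h
      · cases (isConcat_syllable_one_iff.1 h).1
      · cases isConcat_syllable_word_iff.1 h
        exact ⟨hx, hs, hσ⟩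

theorem one_mem_stringsAt : one v i ∈ stringsAt ε v i := ⟨isString_one v i, rfl, rfl⟩

theorem injOn_sgn : Set.InjOn PreWalk.sgn (stringsAt ε v i) := by
  intro x hx y hy h
  induction hw : x.sgn using List.reverseRecOn generalizing x y with
  | nil =>
    have eq_one {z : PreWalk V E} (hz : z ∈ stringsAt ε v i) (hnil : z.sgn = []) : z = one v i := by
      obtain rfl | ⟨_, -, _, hext⟩ := mem_stringsAt_iff.1 hz
      · rfl
      · simp [hext.sgn_eq] at hnil
    rw [eq_one hx hw, eq_one hy (h ▸ hw)]
  | append_singleton w c ih =>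
    have exists_init {z : PreWalk V E} (hz : z ∈ stringsAt ε v i) (hwc : z.sgn = w ++ [c]) :
        ∃ z₀ ∈ stringsAt ε v i, z₀.sgn = w ∧ IsExtension ε z₀ c z := by
      obtain rfl | ⟨z₀, hz₀, d, hext⟩ := mem_stringsAt_iff.1 hz
      · simp [PreWalk.sgn, toList] at hwc
      · obtain ⟨rfl, hd⟩ := List.append_inj' (hext.sgn_eq.symm.trans hwc) rfl
        exact ⟨z₀, hz₀, rfl, List.singleton_inj.1 hd ▸ hext⟩
    obtain ⟨x₀, hx₀, hx₀w, hx₀x⟩ := exists_init hx hw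
    obtain ⟨y₀, hy₀, hy₀w, hy₀y⟩ := exists_init hy (h ▸ hw)
    obtain rfl := ih hx₀ hy₀ (hx₀w.trans hy₀w.symm) hx₀w
    exact hx₀x.unique hy₀y

theorem exists_mem_stringsAt_of_suffix (hx : x ∈ stringsAt ε v i) (hl : l <:+ x.toList) :
    ∃ y ∈ stringsAt ε v i, y.toList = l := by
  induction hn : x.toList generalizing x with
  | nil => exact ⟨x, hx, hn.trans (List.suffix_nil.1 (hn ▸ hl)).symm⟩
  | cons β m ih =>
    rcases List.suffix_cons_iff.1 (hn ▸ hl) with rfl | hlm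
    · exact ⟨x, hx, hn⟩
    · obtain rfl | ⟨y, hy, c, hext⟩ := mem_stringsAt_iff.1 hx
      · cases hn
      · obtain ⟨_, -, hcons⟩ := hext.exists_toList_eq
        obtain ⟨-, rfl⟩ := List.cons.inj (hn.symm.trans hcons)
        exact ih hy hlm rfl

theorem syllable_eq_of_sgn_eq (hx : x ∈ stringsAt ε v i)
    (hy : y ∈ stringsAt ε v i) (hxw : α :: w <:+ x.toList) (hyw : β :: w <:+ y.toList)
    (hsgn : α.sgn = β.sgn) : α = β := by
  obtain ⟨x₁, hx₁, hα⟩ := exists_mem_stringsAt_of_suffix hx hxw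
  obtain ⟨y₁, hy₁, hβ⟩ := exists_mem_stringsAt_of_suffix hy hyw
  obtain rfl := injOn_sgn hx₁ hy₁ (by simp only [PreWalk.sgn, hα, hβ, List.map_cons, hsgn])
  exact (List.cons.inj (hα.symm.trans hβ)).1

theorem inorder_sgn_iff_of_longest_common_suffix (hx : x ∈ stringsAt ε v i)
    (hy : y ∈ stringsAt ε v i) (hxw : x.toList = x' ++ w) (hyw : y.toList = y' ++ w)
    (hw : ∀ a ∈ x'.getLast?, a ∉ y'.getLast?) :
    Inorder x.sgn y.sgn ↔
      (∃ a, x'.getLast? = some (.direct a)) ∨ ∃ a, y'.getLast? = some (.inverse a) := by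
  have suffix_of_mem {z : PreWalk V E} {z' : List (Syllable E)} (hz : z.toList = z' ++ w)
      {α : Syllable E} (hα : α ∈ z'.getLast?) : α :: w <:+ z.toList := by
    obtain ⟨m, rfl⟩ := List.getLast?_eq_some_iff.1 hα
    exact ⟨m, by simp [hz]⟩
  have head?_sgn (m : List (Syllable E)) :
      (m.map Syllable.sgn).reverse.head? = m.getLast?.map Syllable.sgn := by
    rw [List.head?_reverse, List.getLast?_map]
  rw [PreWalk.sgn, PreWalk.sgn, hxw, hyw, List.map_append, List.map_append, List.reverse_append,
    List.reverse_append, Inorder.append_append_iff, Inorder.iff_of_head]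
  · rw [head?_sgn, head?_sgn, Syllable.map_sgn_eq_some_false, Syllable.map_sgn_eq_some_true]
  · simp only [head?_sgn, Option.mem_def, Option.map_eq_some_iff]
    rintro _ ⟨α, hα, rfl⟩ ⟨β, hβ, hsgn⟩
    obtain rfl :=
      syllable_eq_of_sgn_eq hx hy (suffix_of_mem hxw hα) (suffix_of_mem hyw hβ) hsgn.symm
    exact hw _ hα hβ

theorem ltL_iff_inorder_sgn (hx : x ∈ stringsAt ε v i) (hy : y ∈ stringsAt ε v i) :
    x.LtL y ↔ Inorder x.sgn y.sgn := by
  constructor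
  · rintro ⟨w, x', y', hxw, hyw, hw, h⟩
    rw [hxw, hyw, longest_common_suffix_iff] at hw
    exact (inorder_sgn_iff_of_longest_common_suffix hx hy hxw hyw hw).2 h
  · intro h
    obtain ⟨w, x', y', hxw, hyw, hw⟩ := exists_longest_common_suffix x.toList y.toList
    refine ⟨w, x', y', hxw, hyw, ?_,
      (inorder_sgn_iff_of_longest_common_suffix hx hy hxw hyw hw).1 h⟩
    rwa [hxw, hyw, longest_common_suffix_iff]

variable (ε v i) in
/-- The sign sequence as an embedding of `<_l` into the inorder. -/
def sgnEmbedding : stringsAt.lt ε v i ↪r Inorder where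
  toFun x := x.1.sgn
  inj' x y h := Subtype.ext (injOn_sgn x.2 y.2 h)
  map_rel_iff' {x y} := (ltL_iff_inorder_sgn x.2 y.2).symm

instance : IsStrictTotalOrder (stringsAt ε v i) (stringsAt.lt ε v i) :=
  (sgnEmbedding ε v i).isStrictTotalOrder

section Automaton

variable [Finite V] [Finite E] {v' : V} {q₀ q : Λ.Short}

theorem automaton_step_eq_some_iff {p : Λ.Short} :
    (automaton ε v').step p c = some q ↔ ∃ z, IsExtension ε p.1 c z ∧ q.1 = z.truncate Λ := by
  classical
  change (if h : ∃ z, IsExtension ε p.1 c z then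
    some (toShort h.choose h.choose_spec.1) else none) = some q ↔ _
  split_ifs with h
  · rw [Option.some.injEq]
    constructor
    · rintro rfl
      exact ⟨_, h.choose_spec, rfl⟩
    · rintro ⟨z, hz, hq⟩
      obtain rfl := hz.unique h.choose_spec
      exact Subtype.ext hq.symm
  · simp only [false_iff]
    rintro ⟨z, hz, -⟩
    exact h ⟨z, hz⟩

theorem automaton_run_eq_some_iff (hq₀ : q₀.1 = one v i) {w : List Bool} :
    (automaton ε v').run q₀ w = some q ↔
      ∃ x ∈ stringsAt ε v i, x.sgn = w ∧ q.1 = x.truncate Λ := by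
  induction w using List.reverseRecOn generalizing q with
  | nil =>
    constructor
    · intro h
      obtain rfl : q₀ = q := Option.some_injective _ h
      exact ⟨one v i, one_mem_stringsAt, rfl, hq₀⟩
    · rintro ⟨x, hx, hsgn, hq⟩
      obtain rfl : x = one v i := injOn_sgn hx one_mem_stringsAt hsgn
      exact congrArg some (Subtype.ext (hq₀.trans hq.symm))
  | append_singleton w c ih =>
    refine PartialDFA.run_concat_eq_some_iff.trans ?_
    constructor
    · rintro ⟨p, hp, hq⟩
      obtain ⟨x, hx, rfl, hpx⟩ := ih.1 hp
      obtain ⟨z, hz, hqz⟩ :=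
        (exists_isExtension_truncate_iff hx.1).1 (hpx ▸ automaton_step_eq_some_iff.1 hq)
      exact ⟨z, mem_stringsAt_iff.2 (Or.inr ⟨x, hx, c, hz⟩), hz.sgn_eq, hqz⟩
    · rintro ⟨z, hz, hsgn, hqz⟩
      obtain rfl | ⟨x, hx, d, hxz⟩ := mem_stringsAt_iff.1 hz
      · simp [PreWalk.sgn, toList] at hsgn
      · obtain ⟨rfl, hd⟩ := List.append_inj' (hxz.sgn_eq.symm.trans hsgn) rfl
        obtain rfl := List.singleton_inj.1 hd
        exact ⟨toShort x hx.1, ih.2 ⟨x, hx, rfl, rfl⟩, automaton_step_eq_some_iff.2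
          ((exists_isExtension_truncate_iff hx.1).2 ⟨z, hxz, hqz⟩)⟩

theorem bijOn_sgn (hq₀ : q₀.1 = one v i) :
    Set.BijOn PreWalk.sgn (stringsAt ε v i) ((automaton ε v').languageFrom q₀) := by
  refine ⟨fun x hx => ⟨toShort x hx.1, trivial, ?_⟩, injOn_sgn, ?_⟩
  · exact (automaton_run_eq_some_iff hq₀).2 ⟨x, hx, rfl, rfl⟩
  · rintro w ⟨q, -, hw⟩
    obtain ⟨x, hx, hsgn, -⟩ := (automaton_run_eq_some_iff hq₀).1 hw
    exact ⟨x, hx, hsgn⟩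

variable (ε v') in
/-- The sign sequence as an order isomorphism from the strings `x` such that `x 1_(v,i)` is defined
onto the words accepted from the state `1_(v,i)`. -/
noncomputable def sgnRelIso (hq₀ : q₀.1 = one v i) : stringsAt.lt ε v i ≃r
    fun x y : (automaton ε v').languageFrom q₀ => Inorder x.1 y.1 where
  toEquiv := (bijOn_sgn hq₀).equiv
  map_rel_iff' {x y} := (ltL_iff_inorder_sgn x.2 y.2).symm

variable (ε v i) in
theorem isFiniteDescription_stringsAt_lt : IsFiniteDescription (stringsAt.lt ε v i) :=
  ((automaton ε v).finiteDescriptionOn_languageFrom (toShort (one v i) (isString_one v i))).iso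
    ((RelIso.preimage Equiv.ulift _).trans (sgnRelIso ε v rfl).symm)

end Automaton

/-! ### Inversion and the hammocks -/

namespace PreWalk

theorem toList_inv (x : PreWalk V E) : x.inv.toList = (x.toList.map Syllable.inv).reverse := by
  cases x with
  | one v i => rfl
  | word α l => exact List.cons_head_tail _

theorem inv_inv (x : PreWalk V E) : x.inv.inv = x := by
  cases x with
  | one v i => simp [inv]
  | word α l => simp [inv, Function.comp_def, Syllable.inv_inv]

theorem s_inv (x : PreWalk V E) : x.inv.s Λ = x.t Λ := by
  cases x with
  | one v i => rfl
  | word α l => simp [inv, s, t, Syllable.s_inv]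

theorem σ_inv (ε : Λ.Signs) (x : PreWalk V E) : x.inv.σ ε = x.τ ε := by
  cases x with
  | one v i => simp [inv, σ, τ]
  | word α l => simp [inv, σ, τ, Syllable.σ_inv]

theorem IsString.inv {x : PreWalk V E} (h : x.IsString Λ) : x.inv.IsString Λ := by
  have infix_inv {m : List (Syllable E)} (hm : m <:+: x.inv.toList) :
      (m.map Syllable.inv).reverse <:+: x.toList := by
    have := List.reverse_infix.2 (hm.map Syllable.inv)
    rw [toList_inv] at this
    simpa [Function.comp_def, Syllable.inv_inv] using this
  refine ⟨?_, fun p hp hq => h.no_inv_rel p hp ?_, fun p hp hq => h.no_rel p hp ?_, ?_⟩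
  · rw [IsWalk, toList_inv, List.isChain_reverse, List.isChain_map]
    refine h.isWalk.imp fun α β hαβ => ?_
    simpa only [flip, Syllable.s_inv, Syllable.t_inv] using hαβ.symm
  · simpa [Function.comp_def, Syllable.inv] using infix_inv hq
  · simpa [Function.comp_def, Syllable.inv] using infix_inv hq
  · rw [toList_inv, List.isChain_reverse, List.isChain_map]
    refine h.reduced.imp fun α β hαβ hβα => hαβ ?_
    simpa only [Syllable.inv_inv] using hβα.symm

theorem isString_inv_iff {x : PreWalk V E} : x.inv.IsString Λ ↔ x.IsString Λ :=
  ⟨fun h => x.inv_inv ▸ h.inv, IsString.inv⟩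

end PreWalk

variable (ε v)

theorem hammockL_eq_stringsAt : hammockL ε v = stringsAt ε v 1 := by
  ext x
  constructor
  · rintro ⟨⟨x, y⟩, ⟨hx, -, hx₁, -⟩, rfl⟩
    exact ⟨hx, isConcat_one_right_iff.1 hx₁⟩
  · rintro ⟨hx, hx₁⟩
    rw [← isConcat_one_right_iff] at hx₁
    exact ⟨(x, one v 1), ⟨hx, isString_one v 1, hx₁, .one_left _ _ _ rfl rfl, x, hx₁, hx⟩, rfl⟩

theorem hammockR_eq_preimage_stringsAt : hammockR ε v = PreWalk.inv ⁻¹' stringsAt ε v (-1) := by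
  ext x
  rw [Set.mem_preimage, stringsAt, Set.mem_ofPred, isString_inv_iff, s_inv, σ_inv, neg_neg,
    ← isConcat_one_left_iff]
  constructor
  · rintro ⟨⟨y, x⟩, ⟨-, hx, -, hx₁, -⟩, rfl⟩
    exact ⟨hx, hx₁⟩
  · rintro ⟨hx, hx₁⟩
    exact ⟨(one v 1, x), ⟨isString_one v 1, hx, .one_left _ _ _ rfl rfl, hx₁, x, hx₁, hx⟩, rfl⟩

/-- The left hammock at `v` consists of the strings `x` such that `x 1_(v,1)` is defined. -/
def hammockL.relIso : hammockL.lt ε v ≃r stringsAt.lt ε v 1 where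
  toEquiv := Equiv.setCongr (hammockL_eq_stringsAt ε v)
  map_rel_iff' := Iff.rfl

/-- Inversion identifies the right hammock at `v` with the strings `x` such that `x 1_(v,-1)` is
defined. -/
def hammockR.relIso : hammockR.lt ε v ≃r stringsAt.lt ε v (-1) where
  toEquiv := (Equiv.setCongr (hammockR_eq_preimage_stringsAt ε v)).trans
    ((Function.Involutive.toPerm PreWalk.inv inv_inv).subtypeEquiv fun _ => Iff.rfl)
  map_rel_iff' := Iff.rfl

instance : IsStrictTotalOrder (hammockL ε v) (hammockL.lt ε v) :=
  (hammockL.relIso ε v).toRelEmbedding.isStrictTotalOrder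

instance : IsStrictTotalOrder (hammockR ε v) (hammockR.lt ε v) :=
  (hammockR.relIso ε v).toRelEmbedding.isStrictTotalOrder

variable [Finite V] [Finite E]

theorem isFiniteDescription_hammockL_lt : IsFiniteDescription (hammockL.lt ε v) :=
  (isFiniteDescription_stringsAt_lt ε v 1).iso (hammockL.relIso ε v).symm

theorem isFiniteDescription_hammockR_lt : IsFiniteDescription (hammockR.lt ε v) :=
  (isFiniteDescription_stringsAt_lt ε v (-1)).iso (hammockR.relIso ε v).symm

theorem exists_hammockL_relIso_linguage :
    ∃ e : hammockL.lt ε v ≃r (automaton ε v).linguage, ∀ x, (e x).1 = x.1.sgn :=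
  ⟨(hammockL.relIso ε v).trans (sgnRelIso ε v (q₀ := (automaton ε v).start) rfl), fun _ => rfl⟩

end StringAlgebra

theorem mainTheorem1 {V E : Type u} [Finite V] [Finite E] (Λ : StringAlgebra V E)
    (ε : Λ.Signs) (v : V) :
    -- the hammocks are linear orders, and they are finite description linear orders
    (IsStrictTotalOrder (StringAlgebra.hammockL ε v) (StringAlgebra.hammockL.lt ε v) ∧
      IsFiniteDescription (StringAlgebra.hammockL.lt ε v)) ∧
    (IsStrictTotalOrder (StringAlgebra.hammockR ε v) (StringAlgebra.hammockR.lt ε v) ∧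
      IsFiniteDescription (StringAlgebra.hammockR.lt ε v)) ∧
    -- the sign sequence is an isomorphism from the left hammock to the linguage of the automaton
    (∃ e : StringAlgebra.hammockL.lt ε v ≃r (StringAlgebra.automaton ε v).linguage,
      ∀ x, (e x : List Bool) = (x : StringAlgebra.PreWalk V E).sgn) ∧
    -- the word problem of the automaton has a universal solution, whose component at the start
    -- state is the linguage and whose components are finite description linear orders
    (∃ S : WordProblem.Solution (StringAlgebra.automaton ε v).wordProblem, S.IsUniversal) ∧
    (∀ S : WordProblem.Solution (StringAlgebra.automaton ε v).wordProblem, S.IsUniversal →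
      Nonempty ((S.arr (StringAlgebra.automaton ε v).start).lt ≃r
        (StringAlgebra.automaton ε v).linguage) ∧
      ∀ q, IsFiniteDescription (S.arr q).lt) := by
  set M := StringAlgebra.automaton ε v
  obtain ⟨S₀, hS₀, hS₀_arr⟩ := M.exists_isUniversal_arr_eq
  have exists_relIso {S : WordProblem.Solution M.wordProblem} (hS : S.IsUniversal) (q : M.State) :
      Nonempty ((S.arr q).lt ≃r (M.arrangement q).lt) :=
    hS₀_arr ▸ hS.nonempty_relIso hS₀ q
  refine ⟨⟨inferInstance, StringAlgebra.isFiniteDescription_hammockL_lt ε v⟩,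
    ⟨inferInstance, StringAlgebra.isFiniteDescription_hammockR_lt ε v⟩,
    StringAlgebra.exists_hammockL_relIso_linguage ε v, ⟨S₀, hS₀⟩, fun S hS => ⟨?_, fun q => ?_⟩⟩
  · obtain ⟨f⟩ := exists_relIso hS M.start
    exact ⟨f.trans (RelIso.preimage Equiv.ulift M.linguage)⟩
  · obtain ⟨f⟩ := exists_relIso hS q
    exact (M.isFiniteDescription_arrangement q).iso f.symm
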